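/- Let $Y$ be a complex manifold and $D=\sum_{i\in I} D_i\subset Y$ a simple normal crossing divisor: every point of $Y$ is the origin of a holomorphic coordinate system on a neighbourhood in which the $D_i$ through that point are distinct coordinate hyperplanes and the other $D_i$ do not occur. An \emph{arc} in $Y$ is a map $\phi:\overline{\mathbb D}\to Y$ from the closed unit disk that extends to a holomorphic map on a neighbourhood of $\overline{\mathbb D}$; the space of arcs carries the topology of uniform convergence on $\overline{\mathbb D}$. A \emph{short arc} on $(D\subset Y)$ is an arc $\phi$ with $\phi^{-1}(\bigcup_i D_i)=\{0\}$; the space of short arcs, with the subspace topology, is denoted $\operatorname{ShArc}(D\subset Y)$. For such $\phi$ the intersection number $(\phi\cdot D_i)$ is the sum, over the points $p\in\phi^{-1}(D_i)$, of the multiplicity at $p$ of the zero of $F\circ\phi$, where $F$ is a local equation of $D_i$ at $\phi(p)$. For natural numbers $m_i\ge 0$ $(i\in I)$, not all zero, and a connected component $W$ of $\bigcap_{i:\,m_i>0} D_i$, set $$SA(W,m_i:i\in I):=\bigl\{\phi\in \operatorname{ShArc}(D\subset Y):\ \phi(0)\in W \text{ and } (\phi\cdot D_i)=m_i \text{ for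 all } i\in I\bigr\}.$$ Then: 1. every such set $SA(W,m_i:i\in I)$ is connected (and non-empty), and 2. the connected components of $\operatorname{ShArc}(D\subset Y)$ are exactly the sets $SA(W,m_i:i\in I)$. -/

import Mathlib

open scoped Manifold ContDiff Topology

noncomputable section

/-- The set of connected components of a subset `S` of a topological space
(with the subspace topology on `S`), viewed as subsets of the ambient space. -/
def componentsOf {X : Type*} [TopologicalSpace X] (S : Set X) : Set (Set X) :=
  {C | ∃ x ∈ S, C = connectedComponentIn S x}

/-- The closed unit disk in `ℂ`. -/
abbrev ClosedDisk : Type := Metric.closedBall (0 : ℂ) 1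

/-- The origin of the closed unit disk. -/
def diskZero : ClosedDisk := ⟨0, by simp⟩

section

variable (n : ℕ) (Y : Type*) [TopologicalSpace Y] [ChartedSpace (EuclideanSpace ℂ (Fin n)) Y]

/-- `arc(Y)`: complex analytic arcs in the `n`-dimensional complex manifold `Y`, that is, maps
from the closed unit disk to `Y` that extend to a holomorphic map on some open neighbourhood
of the closed disk. As a subtype of `C(ClosedDisk, Y)` it carries the compact-open topology; as
the disk is compact, this is the topology of the metric
`sup {d (φ t) (ψ t) | t ∈ ClosedDisk}` for any metric `d` inducing the topology of `Y`. -/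
def Arc : Type _ :=
  {φ : C(ClosedDisk, Y) // ∃ (U : Set ℂ) (g : ℂ → Y), IsOpen U ∧ Metric.closedBall (0 : ℂ) 1 ⊆ U ∧
    MDifferentiableOn 𝓘(ℂ, ℂ) 𝓘(ℂ, EuclideanSpace ℂ (Fin n)) g U ∧ ∀ t : ClosedDisk, g t = φ t}

instance : TopologicalSpace (Arc n Y) :=
  inferInstanceAs (TopologicalSpace {φ : C(ClosedDisk, Y) // ∃ (U : Set ℂ) (g : ℂ → Y),
    IsOpen U ∧ Metric.closedBall (0 : ℂ) 1 ⊆ U ∧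
    MDifferentiableOn 𝓘(ℂ, ℂ) 𝓘(ℂ, EuclideanSpace ℂ (Fin n)) g U ∧ ∀ t : ClosedDisk, g t = φ t})

end

section

variable {n : ℕ} {Y : Type*} [TopologicalSpace Y] [ChartedSpace (EuclideanSpace ℂ (Fin n)) Y]

namespace Arc

/-- The underlying continuous map of an arc. -/
def toMap (φ : Arc n Y) : C(ClosedDisk, Y) := φ.1

/-- The center `φ(0)` of an arc. -/
def center (φ : Arc n Y) : Y := φ.toMap diskZero

/-- A holomorphic extension of an arc to a neighbourhood of the closed disk. Its germ at each
point of the closed disk is determined by the arc. (Outside that neighbourhood the values are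
arbitrary, and never used.) -/
def extension (φ : Arc n Y) : ℂ → Y := φ.2.choose_spec.choose

/-- The characteristic property of `Arc.extension`. -/
theorem extension_spec (φ : Arc n Y) :
    ∃ U : Set ℂ, IsOpen U ∧ Metric.closedBall (0 : ℂ) 1 ⊆ U ∧
      MDifferentiableOn 𝓘(ℂ, ℂ) 𝓘(ℂ, EuclideanSpace ℂ (Fin n)) φ.extension U ∧
      ∀ t : ClosedDisk, φ.extension t = φ.toMap t :=
  ⟨φ.2.choose, φ.2.choose_spec.choose_spec⟩

end Arc

/-- `sharc(Z ⊂ Y)`: short arcs, that is, arcs `φ` with `φ⁻¹(Z) = {0}` in the closed disk. -/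
def shortArcs (Z : Set Y) : Set (Arc n Y) :=
  {φ | φ.toMap ⁻¹' Z = {diskZero}}

/-- A simple normal crossing divisor `D = ∑ D i`: every point `p` has holomorphic coordinates
`x_1, …, x_n` centered at `p` such that, on the coordinate domain, the `D i` that contain `p` are
pairwise different coordinate hyperplanes `x_{c i} = 0` and the other `D i` are empty.
It follows that each `D i` is a closed complex submanifold of codimension one (or empty) and that
the family is locally finite. -/
def IsSNCDivisor [IsManifold 𝓘(ℂ, EuclideanSpace ℂ (Fin n)) ω Y] {ι : Type*} (D : ι → Set Y) :
    Prop :=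
  ∀ p : Y, ∃ e ∈ IsManifold.maximalAtlas 𝓘(ℂ, EuclideanSpace ℂ (Fin n)) ω Y,
    p ∈ e.source ∧ e p = 0 ∧
    ∃ c : {i : ι // p ∈ D i} → Fin n, Function.Injective c ∧
      (∀ i : {i : ι // p ∈ D i}, D i ∩ e.source = {y ∈ e.source | e y (c i) = 0}) ∧
      ∀ i : ι, p ∉ D i → D i ∩ e.source = ∅

/-- `F` is a (reduced) local equation at `p` of the smooth hypersurface `D`: on some open
neighbourhood `U` of `p` it is holomorphic, its zero set is `D`, and its differential does not
vanish along `D`. -/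
def IsLocalEquation (D : Set Y) (p : Y) (F : Y → ℂ) : Prop :=
  ∃ U : Set Y, IsOpen U ∧ p ∈ U ∧
    MDifferentiableOn 𝓘(ℂ, EuclideanSpace ℂ (Fin n)) 𝓘(ℂ, ℂ) F U ∧
    D ∩ U = {y ∈ U | F y = 0} ∧
    ∀ y ∈ D ∩ U, mfderiv 𝓘(ℂ, EuclideanSpace ℂ (Fin n)) 𝓘(ℂ, ℂ) F y ≠ 0

/-- The local contribution at `t` to the intersection number of the arc `φ` with the smooth
hypersurface `D`: the multiplicity of the zero at `t` of `F ∘ φ`, where `F` is a local equation of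
`D` at `φ(t)`. Two local equations differ by a nowhere vanishing holomorphic factor, so all of
them give the same multiplicity; the infimum is a way to name this common value. -/
def localIntersection (D : Set Y) (φ : Arc n Y) (t : ClosedDisk) : ℕ∞ :=
  ⨅ (F : Y → ℂ) (_ : IsLocalEquation (n := n) D (φ.toMap t) F),
    analyticOrderAt (F ∘ φ.extension) (t : ℂ)

/-- The intersection number `(φ · D)`: the sum of the local contributions over the points of
`φ⁻¹(D)`. (These are finitely many if `φ` does not map the boundary of the disk into `D`, in
particular if `φ` is a short arc for a set that contains `D`.) -/
def intersectionNumber (D : Set Y) (φ : Arc n Y) : ℕ∞ :=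
  ∑ᶠ t ∈ φ.toMap ⁻¹' D, localIntersection D φ t

/-- The stratum `⋂_{i : m i > 0} D i`. -/
def stratum {ι : Type*} (D : ι → Set Y) (m : ι → ℕ) : Set Y :=
  ⋂ (i : ι) (_ : 0 < m i), D i

/-- `SA(W, m_i : i ∈ I)`: the short arcs on `⋃ D i ⊂ Y` whose center is in `W` and that have
intersection number `m i` with `D i` for every `i`. -/
def SA {ι : Type*} (D : ι → Set Y) (W : Set Y) (m : ι → ℕ) : Set (Arc n Y) :=
  {φ | φ ∈ shortArcs (⋃ i, D i) ∧ φ.center ∈ W ∧ ∀ i, intersectionNumber (D i) φ = (m i : ℕ∞)}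

end

end

/-!
Every short arc has a well-defined list of intersection numbers, and the two halves of the statement
say that these numbers, together with the component of the stratum that contains the center, are
locally constant on the space of short arcs and separate its components.

*Intersection numbers.* In a chart where `D i` is the hyperplane `x k = 0`, the intersection number
of a short arc with `D i` is the order at `0` of the `k`-th coordinate of the arc
(`intersectionNumber_eq`). The coordinate itself is a local equation, and any other local equation
`F` is `O(x k)` by the Schwarz lemma on lines parallel to the `k`-th axis
(`isBigO_coord_of_eq_zero`), so its order along the arc is not smaller.

*Local constancy.* Since the coordinates of a short arc have no zero besides the origin, two short
arcs that are uniformly close have the same orders, by the argument of Rouché's theorem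
(`order_eq_of_norm_sub_lt`). As strata are coordinate subspaces in charts, the component of the
stratum does not change either. So each `SA` is open in the space of short arcs
(`eventually_mem_SA`).

*Connectedness.* Let `p ∈ W`, and take a polydisc of a chart at `p`. A short arc of type `m` that is
centered in it has coordinates `t ^ μ k * u k t` near the origin, with `u k` nowhere zero if the
hyperplane `x k = 0` belongs to the divisor. Shrinking the disk and then replacing `u k t` by
`u k (s t)`, `s → 0`, deforms it to a monomial arc `t ^ μ k * b k`
(`IsSNCChart.exists_connectedComponentIn_eq`). The coefficients `b` form a product of discs and
punctured discs, which is connected. Hence all short arcs of type `m` with center near `p` lie in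
one component of `SA`. Such arcs exist with center arbitrarily close to `p`
(`IsSNCDivisor.frequently_center`), so that this component is a locally constant function of
`p ∈ W`; as `W` is connected, there is only one (`IsSNCDivisor.isConnected_SA`).
-/

open scoped Manifold ContDiff Topology

noncomputable section

/-! ### Zeros of holomorphic functions of one variable -/

theorem analyticOrderAt_le_of_isBigO {f g : ℂ → ℂ} (hf : AnalyticAt ℂ f 0) (hg : AnalyticAt ℂ g 0)
    (hfg : f =O[𝓝 0] g) : analyticOrderAt g 0 ≤ analyticOrderAt f 0 := by
  by_cases htop : analyticOrderAt f 0 = ⊤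
  · simp [htop]
  obtain ⟨n, hn⟩ := ENat.ne_top_iff_exists.mp htop
  obtain ⟨u, hu, hu0, hfu⟩ := (hf.analyticOrderAt_eq_natCast).1 hn.symm
  rw [← hn]
  by_contra hlt
  have hle : ((n + 1 : ℕ) : ℕ∞) ≤ analyticOrderAt g 0 := by
    push_cast
    exact Order.add_one_le_of_lt (not_le.1 hlt)
  obtain ⟨v, hv, hgv⟩ := (natCast_le_analyticOrderAt hg).1 hle
  obtain ⟨C, hC⟩ := hfg.bound
  have key : ∀ᶠ z : ℂ in 𝓝[≠] 0, ‖u z‖ ≤ C * (‖z‖ * ‖v z‖) := by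
    filter_upwards [nhdsWithin_le_nhds hfu, nhdsWithin_le_nhds hgv, nhdsWithin_le_nhds hC,
      self_mem_nhdsWithin] with z h1 h2 h3 h4
    have hz : 0 < ‖z‖ ^ n := pow_pos (norm_pos_iff.2 h4) n
    rw [h1, h2] at h3
    simp only [sub_zero, smul_eq_mul, norm_mul, norm_pow, pow_succ] at h3
    refine le_of_mul_le_mul_left ?_ hz
    linarith
  have h1 : Filter.Tendsto (fun z => ‖u z‖) (𝓝[≠] 0) (𝓝 ‖u 0‖) :=
    (hu.continuousAt.norm.tendsto).mono_left nhdsWithin_le_nhds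
  have h2 : Filter.Tendsto (fun z : ℂ => C * (‖z‖ * ‖v z‖)) (𝓝[≠] 0)
      (𝓝 (C * (‖(0 : ℂ)‖ * ‖v 0‖))) :=
    ((continuousAt_const.mul (continuousAt_id.norm.mul hv.continuousAt.norm)).tendsto).mono_left
      nhdsWithin_le_nhds
  have h3 := le_of_tendsto_of_tendsto h1 h2 key
  simp only [norm_zero, zero_mul, mul_zero, norm_le_zero_iff] at h3
  exact hu0 h3

theorem analyticOrderAt_pow_mul {m : ℕ} {u : ℂ → ℂ} (hu : AnalyticAt ℂ u 0) (hu0 : u 0 ≠ 0) :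
    analyticOrderAt (fun t => t ^ m * u t) 0 = m :=
  (((analyticAt_id.pow m).mul hu).analyticOrderAt_eq_natCast).2
    ⟨u, hu, hu0, Filter.Eventually.of_forall fun z => by simp⟩

/-- On all of `V`, not only near the origin, the factor `t ^ m` splits off. -/
theorem DifferentiableOn.exists_eq_pow_mul {f : ℂ → ℂ} {V : Set ℂ} (hV : IsOpen V)
    (h0 : (0 : ℂ) ∈ V) (hf : DifferentiableOn ℂ f V) {m : ℕ} (hm : analyticOrderAt f 0 = m) :
    ∃ u : ℂ → ℂ, DifferentiableOn ℂ u V ∧ u 0 ≠ 0 ∧ ∀ t ∈ V, f t = t ^ m * u t := by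
  obtain ⟨g, hg, hg0, hfg⟩ :=
    ((hf.analyticAt (hV.mem_nhds h0)).analyticOrderAt_eq_natCast).1 hm
  have hne : ∀ t : ℂ, t ≠ 0 → (fun z => if z = 0 then g 0 else f z / z ^ m) =ᶠ[𝓝 t]
      fun z => f z / z ^ m := fun t ht => by
    filter_upwards [isOpen_ne.mem_nhds ht] with z hz
    rw [if_neg hz]
  have heq : (fun z => if z = 0 then g 0 else f z / z ^ m) =ᶠ[𝓝 0] g := by
    filter_upwards [hfg] with z hz
    split_ifs with h
    · rw [h]
    · rw [hz]
      simp [h]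
  refine ⟨fun z => if z = 0 then g 0 else f z / z ^ m, fun t ht => ?_, by simpa using hg0,
    fun t ht => ?_⟩
  · by_cases h : t = 0
    · subst h
      exact (hg.differentiableAt.congr_of_eventuallyEq heq).differentiableWithinAt
    · refine (DifferentiableAt.congr_of_eventuallyEq ?_ (hne t h)).differentiableWithinAt
      exact (hf.differentiableAt (hV.mem_nhds ht)).div (differentiableAt_id.pow m)
        (pow_ne_zero m h)
  · by_cases h : t = 0
    · subst h
      have := hfg.self_of_nhds
      simpa using this
    · simp only [if_neg h]
      field_simp

/-- One half of Rouché's theorem for functions whose only zero is the origin. -/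
theorem order_le_of_norm_sub_lt {f g : ℂ → ℂ} {V : Set ℂ} (hV : IsOpen V) {ε : ℝ} (hε : 0 < ε)
    (hεV : Metric.closedBall (0 : ℂ) ε ⊆ V) (hf : DifferentiableOn ℂ f V)
    (hg : DifferentiableOn ℂ g V) {m l : ℕ} (hm : analyticOrderAt f 0 = m)
    (hl : analyticOrderAt g 0 = l) (hg0 : ∀ t ∈ Metric.closedBall (0 : ℂ) ε, t ≠ 0 → g t ≠ 0)
    (hfg : ∀ t ∈ Metric.sphere (0 : ℂ) ε, ‖f t - g t‖ < ‖g t‖) : m ≤ l := by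
  by_contra! hlt
  have h0 : (0 : ℂ) ∈ V := hεV (Metric.mem_closedBall_self hε.le)
  obtain ⟨u, hu, -, hfu⟩ := hf.exists_eq_pow_mul hV h0 hm
  obtain ⟨v, hv, hv0, hgv⟩ := hg.exists_eq_pow_mul hV h0 hl
  have hvne : ∀ t ∈ Metric.closedBall (0 : ℂ) ε, v t ≠ 0 := by
    intro t ht hvt
    by_cases h : t = 0
    · exact hv0 (h ▸ hvt)
    · exact hg0 t ht h (by rw [hgv t (hεV ht), hvt, mul_zero])
  -- The quotient `f / g` extends over the origin, vanishes there, and is within distance less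
  -- than `1` of `1` on the circle, against the maximum principle.
  have hd : DifferentiableOn ℂ (fun t => t ^ (m - l) * u t / v t - 1)
      (Metric.closedBall (0 : ℂ) ε) := by
    refine DifferentiableOn.sub_const (DifferentiableOn.div ?_ (hv.mono hεV) hvne) _
    exact (differentiableOn_id.pow _).mul (hu.mono hεV)
  have hdc : DiffContOnCl ℂ (fun t => t ^ (m - l) * u t / v t - 1) (Metric.ball (0 : ℂ) ε) := by
    apply DifferentiableOn.diffContOnCl
    rwa [closure_ball _ hε.ne']
  obtain ⟨z, hz, hmax⟩ := Complex.exists_mem_frontier_isMaxOn_norm Metric.isBounded_ball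
    ⟨0, Metric.mem_ball_self hε⟩ hdc
  rw [frontier_ball _ hε.ne'] at hz
  have hz' : z ∈ Metric.closedBall (0 : ℂ) ε := Metric.sphere_subset_closedBall hz
  have hzne : z ≠ 0 := by
    rintro rfl
    simp at hz
    exact hε.ne hz
  have h1 := hmax (subset_closure (Metric.mem_ball_self hε))
  have h2 : z ^ (m - l) * u z / v z - 1 = (f z - g z) / g z := by
    have hmz : z ^ m = z ^ (m - l) * z ^ l := by rw [← pow_add]; congr 1; omega
    have := hvne z hz'
    rw [hfu z (hεV hz'), hgv z (hεV hz'), hmz]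
    field_simp
  have h3 := hfg z hz
  have h4 : 0 < ‖g z‖ := (norm_nonneg _).trans_lt h3
  have hml : m - l ≠ 0 := by omega
  simp only [Set.mem_ofPred_eq, Function.comp_apply, h2, zero_pow hml, zero_mul, zero_div, zero_sub,
    norm_neg, norm_one, norm_div] at h1
  rw [le_div_iff₀ h4] at h1
  linarith

/-- Two functions whose only possible zero is the origin and that are close on a circle have the
same order there. The factor `1 / 2` makes the hypothesis usable in both directions. -/
theorem order_eq_of_norm_sub_lt {f g : ℂ → ℂ} {V : Set ℂ} (hV : IsOpen V) {ε : ℝ} (hε : 0 < ε)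
    (hεV : Metric.closedBall (0 : ℂ) ε ⊆ V) (hf : DifferentiableOn ℂ f V)
    (hg : DifferentiableOn ℂ g V) (hf0 : ∀ t ∈ Metric.closedBall (0 : ℂ) ε, t ≠ 0 → f t ≠ 0)
    (hg0 : ∀ t ∈ Metric.closedBall (0 : ℂ) ε, t ≠ 0 → g t ≠ 0)
    (hfg : ∀ t ∈ Metric.sphere (0 : ℂ) ε, ‖g t - f t‖ < ‖f t‖ / 2)
    (hm : analyticOrderAt f 0 ≠ ⊤) (hl : analyticOrderAt g 0 ≠ ⊤) :
    analyticOrderAt g 0 = analyticOrderAt f 0 := by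
  obtain ⟨m, hm⟩ := ENat.ne_top_iff_exists.mp hm
  obtain ⟨l, hl⟩ := ENat.ne_top_iff_exists.mp hl
  rw [← hm, ← hl]
  congr 1
  apply le_antisymm
  · refine order_le_of_norm_sub_lt hV hε hεV hg hf hl.symm hm.symm hf0 fun t ht => ?_
    have := hfg t ht
    have := norm_nonneg (f t)
    linarith
  · refine order_le_of_norm_sub_lt hV hε hεV hf hg hm.symm hl.symm hg0 fun t ht => ?_
    have h1 := hfg t ht
    have h2 := norm_sub_norm_le (f t) (g t)
    rw [norm_sub_rev] at h1
    linarith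

theorem analyticOrderAt_ne_top_of_ne_zero {f : ℂ → ℂ}
    (hf : ∀ᶠ t in 𝓝[≠] (0 : ℂ), f t ≠ 0) : analyticOrderAt f 0 ≠ ⊤ := by
  intro h
  rw [analyticOrderAt_eq_top] at h
  obtain ⟨t, h1, h2⟩ := (hf.and (nhdsWithin_le_nhds h)).exists
  exact h1 h2

/-! ### Connectedness of polydiscs with punctures -/

theorem isPreconnected_ball_diff_zero (ρ : ℝ) :
    IsPreconnected (Metric.ball (0 : ℂ) ρ \ {0}) := by
  have h : Metric.ball (0 : ℂ) ρ \ {0} =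
      (fun x : ℝ × ℝ => (x.1 : ℂ) * Complex.exp (x.2 * Complex.I)) ''
        (Set.Ioo 0 ρ ×ˢ Set.univ) := by
    ext z
    simp only [Set.mem_sdiff, mem_ball_zero_iff, Set.mem_singleton_iff, Set.mem_image, Set.mem_prod,
      Set.mem_Ioo, Set.mem_univ, and_true, Prod.exists]
    constructor
    · rintro ⟨h1, h2⟩
      exact ⟨‖z‖, z.arg, ⟨norm_pos_iff.2 h2, h1⟩, Complex.norm_mul_exp_arg_mul_I z⟩
    · rintro ⟨r, θ, ⟨h1, h2⟩, rfl⟩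
      refine ⟨?_, by simp [h1.ne']⟩
      rw [norm_mul, Complex.norm_exp_ofReal_mul_I, mul_one, Complex.norm_real,
        Real.norm_of_nonneg h1.le]
      exact h2
  rw [h]
  refine IsPreconnected.image ?_ _ (by fun_prop)
  exact isPreconnected_Ioo.prod isPreconnected_univ

section

variable {n : ℕ}

/-- The open polydisc of polyradius `(ρ, …, ρ)` centered at the origin. -/
def polydisc (n : ℕ) (ρ : ℝ) : Set (EuclideanSpace ℂ (Fin n)) := {x | ∀ k, ‖x k‖ < ρ}

theorem isOpen_polydisc (ρ : ℝ) : IsOpen (polydisc n ρ) := by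
  simp only [polydisc, Set.ofPred_forall]
  exact isOpen_iInter_of_finite fun k => isOpen_lt (by fun_prop) continuous_const

theorem zero_mem_polydisc {ρ : ℝ} (hρ : 0 < ρ) : (0 : EuclideanSpace ℂ (Fin n)) ∈ polydisc n ρ := by
  simpa [polydisc] using fun _ => hρ

theorem exists_polydisc_subset {s : Set (EuclideanSpace ℂ (Fin n))} (hs : s ∈ 𝓝 0) :
    ∃ ρ > 0, polydisc n ρ ⊆ s := by
  have h : (WithLp.toLp 2 : (Fin n → ℂ) → EuclideanSpace ℂ (Fin n)) ⁻¹' s ∈ 𝓝 0 :=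
    (PiLp.continuous_toLp 2 (fun _ : Fin n => ℂ)).continuousAt.preimage_mem_nhds (by simpa using hs)
  obtain ⟨ρ, hρ, h⟩ := Metric.mem_nhds_iff.1 h
  -- Balls of the sup norm are polydiscs.
  refine ⟨ρ, hρ, fun x hx => ?_⟩
  have := @h (WithLp.ofLp x) (by rw [mem_ball_zero_iff, pi_norm_lt_iff hρ]; exact hx)
  simpa using this

theorem isPreconnected_setOf_forall_coord {S : Fin n → Set ℂ} (hS : ∀ k, IsPreconnected (S k)) :
    IsPreconnected {x : EuclideanSpace ℂ (Fin n) | ∀ k, x k ∈ S k} := by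
  have h : {x : EuclideanSpace ℂ (Fin n) | ∀ k, x k ∈ S k} =
      WithLp.toLp 2 '' Set.univ.pi S := by
    ext x
    simp only [Set.mem_ofPred_eq, Set.mem_image, Set.mem_univ_pi]
    exact ⟨fun h => ⟨WithLp.ofLp x, h, rfl⟩, by rintro ⟨y, hy, rfl⟩; exact hy⟩
  rw [h]
  exact (isPreconnected_univ_pi hS).image _ (PiLp.continuous_toLp 2 _).continuousOn

end

/-! ### Arcs in charts -/

section

variable {n : ℕ} {Y : Type*} [TopologicalSpace Y] [ChartedSpace (EuclideanSpace ℂ (Fin n)) Y]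

namespace Arc

/-- The arc obtained by restricting a holomorphic map defined near the closed disk. -/
def ofMDifferentiableOn (g : ℂ → Y) (U : Set ℂ) (hU : IsOpen U)
    (hUb : Metric.closedBall (0 : ℂ) 1 ⊆ U)
    (hg : MDifferentiableOn 𝓘(ℂ, ℂ) 𝓘(ℂ, EuclideanSpace ℂ (Fin n)) g U) : Arc n Y :=
  ⟨⟨fun t => g t, (hg.continuousOn.mono hUb).domRestrict⟩, U, g, hU, hUb, hg, fun _ => rfl⟩

theorem extension_eq (φ : Arc n Y) (t : ClosedDisk) : φ.extension t = φ.toMap t :=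
  φ.extension_spec.choose_spec.2.2.2 t

theorem continuous_toMap : Continuous (toMap : Arc n Y → C(ClosedDisk, Y)) :=
  continuous_subtype_val

theorem continuous_of_uncurry {S : Type*} [TopologicalSpace S] {h : S → Arc n Y}
    (hh : Continuous fun x : S × ClosedDisk => (h x.1).toMap x.2) : Continuous h :=
  continuous_induced_rng.2 (ContinuousMap.continuous_of_continuous_uncurry _ hh)

theorem continuous_eval : Continuous fun x : Arc n Y × ClosedDisk => x.1.toMap x.2 :=
  ContinuousEval.continuous_eval.comp (continuous_toMap.prodMap continuous_id)

theorem continuous_center : Continuous (center : Arc n Y → Y) :=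
  continuous_eval.comp (continuous_id.prodMk continuous_const)

end Arc

/-- The `k`-th coordinate of `ℂⁿ` as a continuous linear form. -/
def coordForm (k : Fin n) : EuclideanSpace ℂ (Fin n) →L[ℂ] ℂ := EuclideanSpace.proj k

@[simp]
theorem coordForm_apply (k : Fin n) (x : EuclideanSpace ℂ (Fin n)) : coordForm k x = x k := rfl

variable {e : OpenPartialHomeomorph Y (EuclideanSpace ℂ (Fin n))}

theorem mdifferentiableOn_of_mem_maximalAtlas
    (he : e ∈ IsManifold.maximalAtlas 𝓘(ℂ, EuclideanSpace ℂ (Fin n)) ω Y) :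
    MDifferentiableOn 𝓘(ℂ, EuclideanSpace ℂ (Fin n)) 𝓘(ℂ, EuclideanSpace ℂ (Fin n)) e e.source :=
  (contMDiffOn_of_mem_maximalAtlas he).mdifferentiableOn (by simp)

theorem mdifferentiableOn_symm_of_mem_maximalAtlas
    (he : e ∈ IsManifold.maximalAtlas 𝓘(ℂ, EuclideanSpace ℂ (Fin n)) ω Y) :
    MDifferentiableOn 𝓘(ℂ, EuclideanSpace ℂ (Fin n)) 𝓘(ℂ, EuclideanSpace ℂ (Fin n)) e.symm
      e.target :=
  (contMDiffOn_symm_of_mem_maximalAtlas he).mdifferentiableOn (by simp)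

/-- The coordinates of an arc are holomorphic on an open subset of the plane that contains the
part of the closed disk mapped into the chart domain. -/
theorem Arc.exists_isOpen_differentiableOn_coord
    (he : e ∈ IsManifold.maximalAtlas 𝓘(ℂ, EuclideanSpace ℂ (Fin n)) ω Y) (φ : Arc n Y) :
    ∃ V : Set ℂ, IsOpen V ∧ (∀ t : ClosedDisk, φ.toMap t ∈ e.source → (t : ℂ) ∈ V) ∧
      (∀ t ∈ V, φ.extension t ∈ e.source) ∧
      MDifferentiableOn 𝓘(ℂ, ℂ) 𝓘(ℂ, EuclideanSpace ℂ (Fin n)) φ.extension V ∧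
      ∀ k, DifferentiableOn ℂ (fun t => e (φ.extension t) k) V := by
  obtain ⟨U, hU, hUb, hd, hφ⟩ := φ.extension_spec
  refine ⟨U ∩ φ.extension ⁻¹' e.source, hd.continuousOn.isOpen_inter_preimage hU e.open_source,
    fun t ht => ⟨hUb t.2, ?_⟩, fun t ht => ht.2, hd.mono Set.inter_subset_left, fun k => ?_⟩
  · rw [Set.mem_preimage, hφ t]
    exact ht
  · have h1 : DifferentiableOn ℂ (fun t => e (φ.extension t)) (U ∩ φ.extension ⁻¹' e.source) :=
      mdifferentiableOn_iff_differentiableOn.1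
        ((mdifferentiableOn_of_mem_maximalAtlas he).comp (hd.mono Set.inter_subset_left)
          fun t ht => ht.2)
    exact (coordForm k).differentiable.comp_differentiableOn h1

theorem isLocalEquation_coord
    (he : e ∈ IsManifold.maximalAtlas 𝓘(ℂ, EuclideanSpace ℂ (Fin n)) ω Y) {D : Set Y} {k : Fin n}
    (hD : D ∩ e.source = {y ∈ e.source | e y k = 0}) {q : Y} (hq : q ∈ e.source) :
    IsLocalEquation (n := n) D q (fun y => e y k) := by
  have hmd : MDifferentiableOn 𝓘(ℂ, EuclideanSpace ℂ (Fin n)) 𝓘(ℂ, ℂ) (fun y => e y k)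
      e.source :=
    (coordForm k).mdifferentiable.comp_mdifferentiableOn
      (mdifferentiableOn_of_mem_maximalAtlas he)
  refine ⟨e.source, e.open_source, hq, hmd, hD, fun y hy h0 => ?_⟩
  -- In the chart the coordinate function is a linear form, whose differential is not zero.
  have hsymm : MDifferentiableAt 𝓘(ℂ, EuclideanSpace ℂ (Fin n)) 𝓘(ℂ, EuclideanSpace ℂ (Fin n))
      e.symm (e y) :=
    (mdifferentiableOn_symm_of_mem_maximalAtlas he).mdifferentiableAt
      (e.open_target.mem_nhds (e.map_source hy.2))
  have hF : HasMFDerivAt 𝓘(ℂ, EuclideanSpace ℂ (Fin n)) 𝓘(ℂ, ℂ) (fun y => e y k)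
      (e.symm (e y)) 0 := by
    rw [e.left_inv hy.2, ← h0]
    exact (hmd.mdifferentiableAt (e.open_source.mem_nhds hy.2)).hasMFDerivAt
  have hcomp := (hF.comp (e y) hsymm.hasMFDerivAt).hasFDerivAt
  have hproj : HasFDerivAt ((fun y => e y k) ∘ e.symm)
      (coordForm k) (e y) := by
    refine (coordForm k).hasFDerivAt.congr_of_eventuallyEq ?_
    filter_upwards [e.open_target.mem_nhds (e.map_source hy.2)] with z hz
    simp [e.right_inv hz]
  have h := hproj.unique hcomp
  have h1 := congrArg (fun L => L (EuclideanSpace.single k (1 : ℂ))) h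
  rw [coordForm_apply, PiLp.single_apply, if_pos rfl] at h1
  exact one_ne_zero (α := ℂ) (h1.trans rfl)

/-- A holomorphic function that vanishes on the coordinate hyperplane `x k = 0` is bounded by a
multiple of `x k`: apply the Schwarz lemma on the lines parallel to the `k`-th axis. -/
theorem isBigO_coord_of_eq_zero {G : EuclideanSpace ℂ (Fin n) → ℂ}
    {O : Set (EuclideanSpace ℂ (Fin n))} (hO : IsOpen O) (hG : DifferentiableOn ℂ G O)
    {k : Fin n} (hzero : ∀ b ∈ O, b k = 0 → G b = 0) {a : EuclideanSpace ℂ (Fin n)} (ha : a ∈ O)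
    (hak : a k = 0) : G =O[𝓝 a] fun b => b k := by
  -- `T b z` is the point `b` with its `k`-th coordinate replaced by `z`.
  let T : EuclideanSpace ℂ (Fin n) → ℂ → EuclideanSpace ℂ (Fin n) :=
    fun b z => b + EuclideanSpace.single k (z - b k)
  have hsingle : Differentiable ℂ
      fun w : ℂ => (EuclideanSpace.single k w : EuclideanSpace ℂ (Fin n)) := by
    rw [differentiable_euclidean]
    intro i
    by_cases h : i = k <;> simp [h]
  have hTcont : Continuous fun x : EuclideanSpace ℂ (Fin n) × ℂ => T x.1 x.2 := by
    exact continuous_fst.add (hsingle.continuous.comp (by fun_prop))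
  have hTdiff : ∀ b, Differentiable ℂ (T b) := fun b => by
    exact (differentiable_const _).add (hsingle.comp (by fun_prop))
  have hTk : ∀ b z, T b z k = z := fun b z => by simp [T]
  have hTself : ∀ b, T b (b k) = b := fun b => by simp [T]
  have hTa : T a 0 = a := by simpa [hak] using hTself a
  have hnear : ∀ᶠ x : EuclideanSpace ℂ (Fin n) × ℂ in 𝓝 (a, 0),
      T x.1 x.2 ∈ O ∧ ‖G (T x.1 x.2)‖ < 1 := by
    have h1 : Filter.Tendsto (fun x : EuclideanSpace ℂ (Fin n) × ℂ => T x.1 x.2)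
        (𝓝 (a, 0)) (𝓝 a) := by
      have := hTcont.tendsto (a, 0)
      simpa only [hTa] using this
    have h2 : ∀ᶠ b in 𝓝 a, ‖G b‖ < 1 := by
      have := (hG.continuousOn.continuousAt (hO.mem_nhds ha)).norm.tendsto
      rw [hzero a ha hak, norm_zero] at this
      exact this.eventually (gt_mem_nhds one_pos)
    exact h1.eventually ((hO.eventually_mem ha).and h2)
  rw [nhds_prod_eq] at hnear
  obtain ⟨p, hp, q, hq, hpq⟩ := Filter.eventually_prod_iff.1 hnear
  obtain ⟨δ, hδ, hδq⟩ := Metric.eventually_nhds_iff_ball.1 hq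
  have hsmall : ∀ᶠ b in 𝓝 a, b k ∈ Metric.ball (0 : ℂ) δ := by
    have h : Continuous fun b : EuclideanSpace ℂ (Fin n) => b k := by fun_prop
    have := h.tendsto a
    rw [hak] at this
    exact this.eventually (Metric.ball_mem_nhds _ hδ)
  refine Asymptotics.IsBigO.of_bound (1 / δ) ?_
  filter_upwards [hp, hsmall] with b hb hbk
  have h0 : G (T b 0) = 0 :=
    hzero _ (hpq hb (hδq 0 (Metric.mem_ball_self hδ))).1 (hTk b 0)
  have hd : DifferentiableOn ℂ (fun z => G (T b z)) (Metric.ball 0 δ) :=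
    hG.comp (hTdiff b).differentiableOn fun z hz => (hpq hb (hδq z hz)).1
  have := Complex.dist_le_div_mul_dist_of_mapsTo_ball (R₂ := 1) hd (fun z hz => by
    simp only [h0, mem_closedBall_zero_iff]
    exact (hpq hb (hδq z hz)).2.le) hbk
  simpa [h0, hTself] using this

/-- If `D` is the hyperplane `x k = 0` of a chart, the local intersection number is the order of
vanishing of the `k`-th coordinate of the arc: every other local equation is bounded by a multiple
of this coordinate, so that it has at least the same order along the arc. -/
theorem localIntersection_eq
    (he : e ∈ IsManifold.maximalAtlas 𝓘(ℂ, EuclideanSpace ℂ (Fin n)) ω Y) {D : Set Y} {k : Fin n}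
    (hD : D ∩ e.source = {y ∈ e.source | e y k = 0}) {φ : Arc n Y} (hφ : φ.center ∈ e.source)
    (hφD : φ.center ∈ D) :
    localIntersection D φ diskZero = analyticOrderAt (fun t => e (φ.extension t) k) 0 := by
  obtain ⟨V, hV, hφV, hVe, hmd, hVd⟩ := φ.exists_isOpen_differentiableOn_coord he
  have h0V : (0 : ℂ) ∈ V := hφV diskZero hφ
  have hext0 : φ.extension 0 = φ.center := φ.extension_eq diskZero
  apply le_antisymm
  · exact iInf₂_le (fun y => e y k) (isLocalEquation_coord he hD hφ)
  refine le_iInf₂ fun F hF => ?_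
  obtain ⟨U, hU, hpU, hFU, hDU, -⟩ := hF
  have hpU : φ.center ∈ U := hpU
  have hOopen : IsOpen (e.target ∩ e.symm ⁻¹' U) := e.isOpen_inter_preimage_symm hU
  have hGd : DifferentiableOn ℂ (fun b => F (e.symm b)) (e.target ∩ e.symm ⁻¹' U) :=
    mdifferentiableOn_iff_differentiableOn.1
      (hFU.comp ((mdifferentiableOn_symm_of_mem_maximalAtlas he).mono Set.inter_subset_left)
        fun b hb => hb.2)
  have hzero : ∀ b ∈ e.target ∩ e.symm ⁻¹' U, b k = 0 → F (e.symm b) = 0 := fun b hb hbk => by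
    have h1 : e.symm b ∈ D ∩ e.source := by
      rw [hD]
      exact ⟨e.map_target hb.1, by rw [e.right_inv hb.1, hbk]⟩
    have h2 : e.symm b ∈ D ∩ U := ⟨h1.1, hb.2⟩
    rw [hDU] at h2
    exact h2.2
  have hak : e φ.center k = 0 := by
    have h1 : φ.center ∈ D ∩ e.source := ⟨hφD, hφ⟩
    rw [hD] at h1
    exact h1.2
  have hbig := isBigO_coord_of_eq_zero hOopen hGd hzero
    (a := e φ.center) ⟨e.map_source hφ, by rwa [Set.mem_preimage, e.left_inv hφ]⟩ hak
  have hcont : ContinuousAt φ.extension 0 := hmd.continuousOn.continuousAt (hV.mem_nhds h0V)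
  have htend : Filter.Tendsto (fun t => e (φ.extension t)) (𝓝 0) (𝓝 (e φ.center)) := by
    rw [← hext0]
    exact (e.continuousAt (hext0 ▸ hφ)).comp hcont
  have hVU : IsOpen (V ∩ φ.extension ⁻¹' U) := hmd.continuousOn.isOpen_inter_preimage hV hU
  have hFd : DifferentiableOn ℂ (F ∘ φ.extension) (V ∩ φ.extension ⁻¹' U) :=
    mdifferentiableOn_iff_differentiableOn.1
      (hFU.comp (hmd.mono Set.inter_subset_left) fun t ht => ht.2)
  refine analyticOrderAt_le_of_isBigO
    (hFd.analyticAt (hVU.mem_nhds ⟨h0V, by rwa [Set.mem_preimage, hext0]⟩))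
    ((hVd k).analyticAt (hV.mem_nhds h0V)) ?_
  refine (hbig.comp_tendsto htend).congr' ?_ Filter.EventuallyEq.rfl
  filter_upwards [hV.mem_nhds h0V] with t ht
  simp [e.left_inv (hVe t ht)]

/-! ### Intersection numbers of short arcs -/

variable {ι : Type*} {D : ι → Set Y}

theorem shortArcs_center_mem {Z : Set Y} {φ : Arc n Y} (hφ : φ ∈ shortArcs Z) : φ.center ∈ Z := by
  have h : diskZero ∈ φ.toMap ⁻¹' Z := by
    rw [show φ.toMap ⁻¹' Z = {diskZero} from hφ]
    rfl
  exact h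

theorem shortArcs_eq_diskZero {Z : Set Y} {φ : Arc n Y} (hφ : φ ∈ shortArcs Z) {t : ClosedDisk}
    (ht : φ.toMap t ∈ Z) : t = diskZero := by
  have h : t ∈ φ.toMap ⁻¹' Z := ht
  rwa [show φ.toMap ⁻¹' Z = {diskZero} from hφ] at h

theorem intersectionNumber_eq_zero {φ : Arc n Y} (hφ : φ ∈ shortArcs (⋃ i, D i)) {i : ι}
    (hi : φ.center ∉ D i) : intersectionNumber (D i) φ = 0 := by
  have h : φ.toMap ⁻¹' D i = ∅ := by
    refine Set.eq_empty_of_forall_notMem fun t ht => hi ?_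
    have := shortArcs_eq_diskZero hφ (Set.mem_iUnion.2 ⟨i, ht⟩)
    rw [this] at ht
    exact ht
  rw [intersectionNumber, h]
  simp

theorem intersectionNumber_eq
    (he : e ∈ IsManifold.maximalAtlas 𝓘(ℂ, EuclideanSpace ℂ (Fin n)) ω Y) {i : ι} {k : Fin n}
    (hD : D i ∩ e.source = {y ∈ e.source | e y k = 0}) {φ : Arc n Y}
    (hφ : φ ∈ shortArcs (⋃ i, D i)) (hφe : φ.center ∈ e.source) :
    intersectionNumber (D i) φ = analyticOrderAt (fun t => e (φ.extension t) k) 0 := by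
  by_cases hi : φ.center ∈ D i
  · have h : φ.toMap ⁻¹' D i = {diskZero} := by
      refine Set.eq_singleton_iff_unique_mem.2 ⟨hi, fun t ht => ?_⟩
      exact shortArcs_eq_diskZero hφ (Set.mem_iUnion.2 ⟨i, ht⟩)
    rw [intersectionNumber, h, finsum_mem_singleton, localIntersection_eq he hD hφe hi]
  · rw [intersectionNumber_eq_zero hφ hi, eq_comm, analyticOrderAt_eq_zero]
    refine Or.inr fun h0 => hi ?_
    rw [show φ.extension 0 = φ.center from φ.extension_eq diskZero] at h0
    have : φ.center ∈ D i ∩ e.source := by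
      rw [hD]
      exact ⟨hφe, h0⟩
    exact this.1

/-- Off the origin the coordinate of a short arc cutting out a component of the divisor does not
vanish. -/
theorem coord_ne_zero {i : ι} {k : Fin n} (hD : D i ∩ e.source = {y ∈ e.source | e y k = 0})
    {φ : Arc n Y} (hφ : φ ∈ shortArcs (⋃ i, D i)) {t : ℂ} (ht : t ∈ Metric.closedBall (0 : ℂ) 1)
    (hte : φ.extension t ∈ e.source) (ht0 : t ≠ 0) : e (φ.extension t) k ≠ 0 := by
  intro h0
  have h1 : φ.extension t ∈ D i ∩ e.source := by
    rw [hD]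
    exact ⟨hte, h0⟩
  rw [φ.extension_eq ⟨t, ht⟩] at h1
  have h2 := shortArcs_eq_diskZero hφ (Set.mem_iUnion.2 ⟨i, h1.1⟩)
  exact ht0 (congrArg Subtype.val h2)

theorem analyticOrderAt_coord_ne_top
    (he : e ∈ IsManifold.maximalAtlas 𝓘(ℂ, EuclideanSpace ℂ (Fin n)) ω Y) {i : ι} {k : Fin n}
    (hD : D i ∩ e.source = {y ∈ e.source | e y k = 0})
    {φ : Arc n Y} (hφ : φ ∈ shortArcs (⋃ i, D i)) (hφe : φ.center ∈ e.source) :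
    analyticOrderAt (fun t => e (φ.extension t) k) 0 ≠ ⊤ := by
  obtain ⟨V, hV, hφV, hVe, -⟩ := φ.exists_isOpen_differentiableOn_coord he
  apply analyticOrderAt_ne_top_of_ne_zero
  filter_upwards [self_mem_nhdsWithin, nhdsWithin_le_nhds (hV.mem_nhds (hφV diskZero hφe)),
    nhdsWithin_le_nhds (Metric.closedBall_mem_nhds (0 : ℂ) one_pos)] with t h1 h2 h3
  exact coord_ne_zero hD hφ h3 (hVe t h2) h1

end

/-! ### Strata in charts adapted to the divisor -/

section

variable {n : ℕ} {Y : Type*} [TopologicalSpace Y] [ChartedSpace (EuclideanSpace ℂ (Fin n)) Y]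
  {ι : Type*}

/-- A chart `e` centered at `p` in which the components `D i` through `p` are the distinct
coordinate hyperplanes `x (c i) = 0` and which the other components do not meet. -/
structure IsSNCChart (D : ι → Set Y) (p : Y)
    (e : OpenPartialHomeomorph Y (EuclideanSpace ℂ (Fin n))) (c : {i : ι // p ∈ D i} → Fin n) :
    Prop where
  mem_maximalAtlas : e ∈ IsManifold.maximalAtlas 𝓘(ℂ, EuclideanSpace ℂ (Fin n)) ω Y
  mem_source : p ∈ e.source
  apply_center : e p = 0
  injective : Function.Injective c
  hyperplane : ∀ i : {i : ι // p ∈ D i}, D i ∩ e.source = {y ∈ e.source | e y (c i) = 0}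
  disjoint : ∀ i : ι, p ∉ D i → D i ∩ e.source = ∅

theorem IsSNCDivisor.exists_isSNCChart [IsManifold 𝓘(ℂ, EuclideanSpace ℂ (Fin n)) ω Y]
    {D : ι → Set Y} (hD : IsSNCDivisor (n := n) D) (p : Y) :
    ∃ e c, IsSNCChart (n := n) D p e c := by
  obtain ⟨e, he, hp, h0, c, hc, h1, h2⟩ := hD p
  exact ⟨e, c, he, hp, h0, hc, h1, h2⟩

/-- The exponent of the `k`-th coordinate of an arc with intersection numbers `m`: it is `m i` if
the `k`-th coordinate hyperplane is `D i`, and `0` if that hyperplane is not part of the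
divisor. -/
def coordExponent {D : ι → Set Y} {p : Y} (c : {i : ι // p ∈ D i} → Fin n) (m : ι → ℕ) :
    Fin n → ℕ :=
  Function.extend c (fun i => m i) 0

namespace IsSNCChart

variable {D : ι → Set Y} {p : Y} {e : OpenPartialHomeomorph Y (EuclideanSpace ℂ (Fin n))}
  {c : {i : ι // p ∈ D i} → Fin n} {m : ι → ℕ}

theorem mem_iff (h : IsSNCChart D p e c) {y : Y} (hy : y ∈ e.source) {i : ι} (hi : p ∈ D i) :
    y ∈ D i ↔ e y (c ⟨i, hi⟩) = 0 := by
  have h1 := Set.ext_iff.1 (h.hyperplane ⟨i, hi⟩) y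
  simpa [hy] using h1

theorem center_mem_of_mem (h : IsSNCChart D p e c) {y : Y} (hy : y ∈ e.source) {i : ι}
    (hi : y ∈ D i) : p ∈ D i := by
  by_contra hp
  have h1 : y ∈ D i ∩ e.source := ⟨hi, hy⟩
  rw [h.disjoint i hp] at h1
  exact h1

theorem coordExponent_apply (h : IsSNCChart D p e c) (i : {i : ι // p ∈ D i}) :
    coordExponent c m (c i) = m i :=
  h.injective.extend_apply _ _ i

theorem mem_stratum_iff (h : IsSNCChart D p e c) (hp : p ∈ stratum D m) {y : Y}
    (hy : y ∈ e.source) : y ∈ stratum D m ↔ ∀ k, coordExponent c m k ≠ 0 → e y k = 0 := by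
  simp only [stratum, Set.mem_iInter] at hp ⊢
  constructor
  · intro hyD k hk
    by_cases hkc : ∃ i, c i = k
    · obtain ⟨i, rfl⟩ := hkc
      rw [h.coordExponent_apply] at hk
      exact (h.mem_iff hy i.2).1 (hyD i (Nat.pos_of_ne_zero hk))
    · exact absurd (Function.extend_apply' _ _ _ hkc) hk
  · intro hk i hi
    rw [h.mem_iff hy (hp i hi)]
    refine hk _ ?_
    rw [h.coordExponent_apply]
    exact hi.ne'

/-- In a polydisc the stratum is a coordinate subspace, hence connected. -/
theorem mem_connectedComponentIn (h : IsSNCChart D p e c) (hp : p ∈ stratum D m) {ρ : ℝ}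
    (hρ : polydisc n ρ ⊆ e.target) {y z : Y} (hy : y ∈ e.source) (hyρ : e y ∈ polydisc n ρ)
    (hyD : y ∈ stratum D m) (hz : z ∈ e.source) (hzρ : e z ∈ polydisc n ρ)
    (hzD : z ∈ stratum D m) : z ∈ connectedComponentIn (stratum D m) y := by
  classical
  let S : Fin n → Set ℂ := fun k => if coordExponent c m k = 0 then Metric.ball 0 ρ else {0}
  have hS : ∀ k, IsPreconnected (S k) := fun k => by
    by_cases hk : coordExponent c m k = 0
    · simpa only [S, if_pos hk] using (convex_ball (0 : ℂ) ρ).isPreconnected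
    · simpa only [S, if_neg hk] using isPreconnected_singleton
  have hmem : ∀ w ∈ e.source, e w ∈ polydisc n ρ → w ∈ stratum D m → ∀ k, e w k ∈ S k := by
    intro w hw hwρ hwD k
    by_cases hk : coordExponent c m k = 0
    · simpa only [S, if_pos hk, mem_ball_zero_iff] using hwρ k
    · simpa only [S, if_neg hk, Set.mem_singleton_iff] using (h.mem_stratum_iff hp hw).1 hwD k hk
  have hρ0 : 0 < ρ ∨ IsEmpty (Fin n) := by
    by_cases hn : IsEmpty (Fin n)
    · exact Or.inr hn
    · obtain ⟨k⟩ := not_isEmpty_iff.1 hn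
      exact Or.inl ((norm_nonneg _).trans_lt (hyρ k))
  have hSρ : {x : EuclideanSpace ℂ (Fin n) | ∀ k, x k ∈ S k} ⊆ polydisc n ρ := by
    intro x hx k
    have hxk := hx k
    by_cases hk : coordExponent c m k = 0
    · simpa only [S, if_pos hk, mem_ball_zero_iff] using hxk
    · simp only [S, if_neg hk, Set.mem_singleton_iff] at hxk
      rw [hxk, norm_zero]
      exact hρ0.resolve_right fun hn => hn.elim k
  have hpre : IsPreconnected (e.symm '' {x : EuclideanSpace ℂ (Fin n) | ∀ k, x k ∈ S k}) :=
    (isPreconnected_setOf_forall_coord hS).image _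
      (e.continuousOn_symm.mono (hSρ.trans hρ))
  refine hpre.subset_connectedComponentIn ⟨e y, hmem y hy hyρ hyD, e.left_inv hy⟩ ?_
    ⟨e z, hmem z hz hzρ hzD, e.left_inv hz⟩
  rintro _ ⟨x, hx, rfl⟩
  have hxt := hρ (hSρ hx)
  rw [h.mem_stratum_iff hp (e.map_target hxt), e.right_inv hxt]
  intro k hk
  have hxk := hx k
  simpa only [S, if_neg hk, Set.mem_singleton_iff] using hxk

theorem exists_polydisc_subset_target (h : IsSNCChart D p e c) {V : Set Y} (hV : V ∈ 𝓝 p) :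
    ∃ ρ > 0, polydisc n ρ ⊆ e.target ∧ ∀ x ∈ polydisc n ρ, e.symm x ∈ V := by
  have h0 : (0 : EuclideanSpace ℂ (Fin n)) ∈ e.target := by
    rw [← h.apply_center]
    exact e.map_source h.mem_source
  have hcont : Filter.Tendsto e.symm (𝓝 0) (𝓝 p) := by
    have := e.tendsto_symm h.mem_source
    rwa [h.apply_center] at this
  obtain ⟨ρ, hρ, hs⟩ := exists_polydisc_subset
    (Filter.inter_mem (e.open_target.mem_nhds h0) (hcont hV))
  exact ⟨ρ, hρ, fun x hx => (hs hx).1, fun x hx => (hs hx).2⟩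

theorem preimage_polydisc_mem_nhds (h : IsSNCChart D p e c) {ρ : ℝ} (hρ : 0 < ρ) :
    ∀ᶠ y in 𝓝 p, y ∈ e.source ∧ e y ∈ polydisc n ρ := by
  refine (e.open_source.eventually_mem h.mem_source).and ?_
  have := e.continuousAt h.mem_source
  rw [ContinuousAt, h.apply_center] at this
  exact this.eventually ((isOpen_polydisc ρ).eventually_mem (zero_mem_polydisc hρ))

/-- The intersection numbers are locally constant on the space of short arcs: near `φ` all
coordinates on a small circle are close to those of `φ`, and the components of the divisor that
do not contain the center stay away. -/
theorem eventually_intersectionNumber_eq (h : IsSNCChart D p e c) {φ : Arc n Y}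
    (hφ : φ ∈ shortArcs (⋃ i, D i)) (hp : φ.center = p) :
    ∀ᶠ ψ in 𝓝[shortArcs (⋃ i, D i)] φ,
      ∀ i, intersectionNumber (D i) ψ = intersectionNumber (D i) φ := by
  have he := h.mem_maximalAtlas
  have hfin : Finite {i : ι // p ∈ D i} := Finite.of_injective c h.injective
  have hφe : φ.center ∈ e.source := hp ▸ h.mem_source
  obtain ⟨V, hV, hφV, hVe, hmd, hVd⟩ := φ.exists_isOpen_differentiableOn_coord he
  obtain ⟨ε', hε', hball⟩ := Metric.nhds_basis_closedBall.mem_iff.1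
    (hV.mem_nhds (hφV diskZero hφe))
  obtain ⟨ε, hε, hε1, hεε'⟩ : ∃ ε > 0, ε ≤ 1 ∧ ε ≤ ε' :=
    ⟨min 1 ε', lt_min one_pos hε', min_le_left _ _, min_le_right _ _⟩
  have hεV : Metric.closedBall (0 : ℂ) ε ⊆ V :=
    (Metric.closedBall_subset_closedBall hεε').trans hball
  have hε1' : Metric.closedBall (0 : ℂ) ε ⊆ Metric.closedBall 0 1 :=
    Metric.closedBall_subset_closedBall hε1
  have heval : ∀ t : ClosedDisk, Filter.Tendsto (fun x : Arc n Y × ClosedDisk => x.1.toMap x.2)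
      (𝓝 (φ, t)) (𝓝 (φ.toMap t)) := fun t => Arc.continuous_eval.tendsto (φ, t)
  have hφt : ∀ t : ClosedDisk, (t : ℂ) ∈ Metric.closedBall (0 : ℂ) ε → φ.toMap t ∈ e.source :=
    fun t ht => by rw [← φ.extension_eq]; exact hVe _ (hεV ht)
  -- Arcs close to `φ` map the disk of radius `ε` into the chart domain (`hE1`), and on its boundary
  -- circle their coordinates are closer to those of `φ` than half the norm of the latter (`hE2`).
  have hE1 : ∀ᶠ ψ in 𝓝 φ, ∀ t ∈ {t : ClosedDisk | (t : ℂ) ∈ Metric.closedBall (0 : ℂ) ε},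
      ψ.toMap t ∈ e.source := by
    refine IsCompact.eventually_forall_of_forall_eventually (IsClosed.isCompact
      (Metric.isClosed_closedBall.preimage continuous_subtype_val))
      fun t ht => ?_
    exact (heval t).eventually (e.open_source.eventually_mem (hφt t ht))
  have hE2 : ∀ᶠ ψ in 𝓝 φ, ∀ t ∈ {t : ClosedDisk | (t : ℂ) ∈ Metric.sphere (0 : ℂ) ε},
      ∀ i, ‖e (ψ.toMap t) (c i) - e (φ.toMap t) (c i)‖ < ‖e (φ.toMap t) (c i)‖ / 2 := by
    refine IsCompact.eventually_forall_of_forall_eventually (IsClosed.isCompact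
      (Metric.isClosed_sphere.preimage continuous_subtype_val))
      fun t ht => Filter.eventually_all.2 fun i => ?_
    have ht' : (t : ℂ) ∈ Metric.closedBall (0 : ℂ) ε := Metric.sphere_subset_closedBall ht
    have hte := hφt t ht'
    have hcoord : ContinuousAt (fun y => e y (c i)) (φ.toMap t) :=
      (coordForm (c i)).continuous.continuousAt.comp (e.continuousAt hte)
    have h1 := hcoord.tendsto.comp (heval t)
    have h2 : Filter.Tendsto (fun x : Arc n Y × ClosedDisk => φ.toMap x.2)
        (𝓝 (φ, t)) (𝓝 (φ.toMap t)) := (φ.toMap.continuous.comp continuous_snd).tendsto (φ, t)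
    have h3 := hcoord.tendsto.comp h2
    refine (h1.sub h3).norm.eventually_lt (h3.norm.div_const 2) ?_
    have hne : e (φ.toMap t) (c i) ≠ 0 := by
      have := coord_ne_zero (h.hyperplane i) hφ t.2 (hVe _ (hεV ht'))
      rw [φ.extension_eq] at this
      refine this fun h0 => ?_
      have ht'' : (t : ℂ) ∈ Metric.sphere (0 : ℂ) ε := ht
      rw [h0, mem_sphere_zero_iff_norm, norm_zero] at ht''
      exact hε.ne ht''
    simpa using hne
  filter_upwards [nhdsWithin_le_nhds hE1, nhdsWithin_le_nhds hE2, self_mem_nhdsWithin]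
    with ψ h1 h2 hψ i
  have hψe : ψ.center ∈ e.source := h1 diskZero (Metric.mem_closedBall_self hε.le)
  by_cases hi : p ∈ D i
  swap
  · rw [intersectionNumber_eq_zero hψ fun hi' => hi (h.center_mem_of_mem hψe hi'),
      intersectionNumber_eq_zero hφ fun hi' => hi (h.center_mem_of_mem hφe hi')]
  have hDi := h.hyperplane ⟨i, hi⟩
  rw [intersectionNumber_eq he hDi hψ hψe, intersectionNumber_eq he hDi hφ hφe]
  obtain ⟨V', hV', hψV', hVe', -, hVd'⟩ := ψ.exists_isOpen_differentiableOn_coord he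
  have hεV' : Metric.closedBall (0 : ℂ) ε ⊆ V' := fun t ht =>
    hψV' ⟨t, hε1' ht⟩ (h1 ⟨t, hε1' ht⟩ ht)
  refine order_eq_of_norm_sub_lt (hV.inter hV') hε (Set.subset_inter hεV hεV')
    ((hVd _).mono Set.inter_subset_left) ((hVd' _).mono Set.inter_subset_right)
    (fun t ht => coord_ne_zero hDi hφ (hε1' ht) (hVe _ (hεV ht)))
    (fun t ht => coord_ne_zero hDi hψ (hε1' ht) (hVe' _ (hεV' ht))) (fun t ht => ?_)
    (analyticOrderAt_coord_ne_top he hDi hφ hφe) (analyticOrderAt_coord_ne_top he hDi hψ hψe)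
  have ht1 : t ∈ Metric.closedBall (0 : ℂ) 1 := hε1' (Metric.sphere_subset_closedBall ht)
  have := h2 ⟨t, ht1⟩ ht ⟨i, hi⟩
  rwa [← φ.extension_eq ⟨t, ht1⟩, ← ψ.extension_eq ⟨t, ht1⟩] at this

end IsSNCChart

theorem center_mem_stratum {D : ι → Set Y} {m : ι → ℕ} {φ : Arc n Y}
    (hφ : φ ∈ shortArcs (⋃ i, D i)) (hm : ∀ i, intersectionNumber (D i) φ = (m i : ℕ∞)) :
    φ.center ∈ stratum D m := by
  simp only [stratum, Set.mem_iInter]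
  intro i hi
  by_contra h
  have := hm i
  rw [intersectionNumber_eq_zero hφ h] at this
  exact hi.ne (by exact_mod_cast this)

/-- Each `SA` is open in the space of short arcs. -/
theorem eventually_mem_SA [IsManifold 𝓘(ℂ, EuclideanSpace ℂ (Fin n)) ω Y]
    {D : ι → Set Y} (hD : IsSNCDivisor (n := n) D) {m : ι → ℕ} {φ : Arc n Y} {W : Set Y}
    (hW : W ∈ componentsOf (stratum D m)) (hφ : φ ∈ SA (n := n) D W m) :
    ∀ᶠ ψ in 𝓝[shortArcs (⋃ i, D i)] φ, ψ ∈ SA (n := n) D W m := by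
  obtain ⟨hφs, hφW, hφm⟩ := hφ
  obtain ⟨x, -, rfl⟩ := hW
  obtain ⟨e, c, h⟩ := hD.exists_isSNCChart φ.center
  obtain ⟨ρ, hρ, hρt, -⟩ := h.exists_polydisc_subset_target Filter.univ_mem
  have hcen : ∀ᶠ ψ in 𝓝 φ, ψ.center ∈ e.source ∧ e ψ.center ∈ polydisc n ρ :=
    (Arc.continuous_center.tendsto φ).eventually (h.preimage_polydisc_mem_nhds hρ)
  filter_upwards [h.eventually_intersectionNumber_eq hφs rfl, nhdsWithin_le_nhds hcen,
    self_mem_nhdsWithin] with ψ h1 h2 hψ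
  have hψm : ∀ i, intersectionNumber (D i) ψ = (m i : ℕ∞) := fun i => (h1 i).trans (hφm i)
  refine ⟨hψ, ?_, hψm⟩
  have hφD := center_mem_stratum hφs hφm
  rw [connectedComponentIn_eq hφW]
  refine h.mem_connectedComponentIn hφD hρt h.mem_source ?_ hφD h2.1 h2.2
    (center_mem_stratum hψ hψm)
  rw [h.apply_center]
  exact zero_mem_polydisc hρ

/-- Every short arc lies in some `SA`. -/
theorem exists_mem_SA [IsManifold 𝓘(ℂ, EuclideanSpace ℂ (Fin n)) ω Y]
    {D : ι → Set Y} (hD : IsSNCDivisor (n := n) D) {φ : Arc n Y}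
    (hφ : φ ∈ shortArcs (⋃ i, D i)) :
    ∃ m : ι → ℕ, m ≠ 0 ∧ ∃ W ∈ componentsOf (stratum D m), φ ∈ SA (n := n) D W m := by
  obtain ⟨e, c, h⟩ := hD.exists_isSNCChart φ.center
  have hord : ∀ (i : ι) (hi : φ.center ∈ D i), intersectionNumber (D i) φ =
      analyticOrderAt (fun t => e (φ.extension t) (c ⟨i, hi⟩)) 0 := fun i hi =>
    intersectionNumber_eq h.mem_maximalAtlas (h.hyperplane ⟨i, hi⟩) hφ h.mem_source
  have hm : ∀ i, intersectionNumber (D i) φ = ((intersectionNumber (D i) φ).toNat : ℕ∞) := by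
    intro i
    refine (ENat.natCast_toNat ?_).symm
    by_cases hi : φ.center ∈ D i
    · rw [hord i hi]
      exact analyticOrderAt_coord_ne_top h.mem_maximalAtlas (h.hyperplane ⟨i, hi⟩) hφ h.mem_source
    · simp [intersectionNumber_eq_zero hφ hi]
  have hW := center_mem_stratum hφ hm
  refine ⟨_, fun h0 => ?_, _, ⟨φ.center, hW, rfl⟩, hφ, mem_connectedComponentIn hW, hm⟩
  obtain ⟨i, hi⟩ := Set.mem_iUnion.1 (shortArcs_center_mem hφ)
  obtain ⟨V, hV, hφV, -, -, hVd⟩ := φ.exists_isOpen_differentiableOn_coord h.mem_maximalAtlas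
  have h1 := hm i
  rw [congrFun h0 i, hord i hi] at h1
  have h0V : (0 : ℂ) ∈ V := hφV diskZero h.mem_source
  refine ((hVd _).analyticAt (hV.mem_nhds h0V)).analyticOrderAt_ne_zero.2 ?_ (by simpa using h1)
  rw [show φ.extension 0 = φ.center from φ.extension_eq diskZero]
  exact (h.mem_iff h.mem_source hi).1 hi

end

/-! ### Coefficients of monomial arcs -/

section

variable {n : ℕ}

/-- The coefficients of monomial arcs in a polydisc: the coordinates with index in the range of `c`,
those that cut out the divisor, must not vanish. -/
def monomialCoeffs (ρ : ℝ) {κ : Type*} (c : κ → Fin n) :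
    Set (EuclideanSpace ℂ (Fin n)) :=
  {b | b ∈ polydisc n ρ ∧ ∀ i, b (c i) ≠ 0}

/-- The point with coordinates `t ^ μ k * b k`; as `t` varies, it runs through a monomial arc. -/
def monomialPoint (μ : Fin n → ℕ) (b : EuclideanSpace ℂ (Fin n)) (t : ℂ) :
    EuclideanSpace ℂ (Fin n) :=
  WithLp.toLp 2 fun k => t ^ μ k * b k

theorem continuous_monomialPoint (μ : Fin n → ℕ) :
    Continuous fun x : EuclideanSpace ℂ (Fin n) × ℂ => monomialPoint μ x.1 x.2 := by
  unfold monomialPoint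
  fun_prop

theorem monomialPoint_mem_polydisc {ρ : ℝ} (μ : Fin n → ℕ) {b : EuclideanSpace ℂ (Fin n)}
    (hb : b ∈ polydisc n ρ) {t : ℂ} (ht : t ∈ Metric.closedBall (0 : ℂ) 1) :
    monomialPoint μ b t ∈ polydisc n ρ := by
  intro k
  rw [mem_closedBall_zero_iff] at ht
  simp only [monomialPoint, norm_mul, norm_pow]
  exact (mul_le_of_le_one_left (norm_nonneg _) (pow_le_one₀ (norm_nonneg _) ht)).trans_lt (hb k)

theorem isPreconnected_monomialCoeffs {κ : Type*} (c : κ → Fin n) (ρ : ℝ) :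
    IsPreconnected (monomialCoeffs ρ c) := by
  classical
  have h : monomialCoeffs ρ c = {b | ∀ k, b k ∈
      if k ∈ Set.range c then Metric.ball (0 : ℂ) ρ \ {0} else Metric.ball (0 : ℂ) ρ} := by
    ext b
    simp only [monomialCoeffs, polydisc, Set.mem_ofPred_eq]
    constructor
    · rintro ⟨h1, h2⟩ k
      split_ifs with hk
      · obtain ⟨i, rfl⟩ := hk
        exact ⟨by simpa using h1 _, h2 i⟩
      · simpa using h1 k
    · intro hb
      refine ⟨fun k => ?_, fun i => ?_⟩
      · have := hb k
        split_ifs at this with hk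
        · simpa using this.1
        · simpa using this
      · have := hb (c i)
        rw [if_pos (Set.mem_range_self i)] at this
        exact this.2
  rw [h]
  refine isPreconnected_setOf_forall_coord fun k => ?_
  split_ifs
  · exact isPreconnected_ball_diff_zero ρ
  · exact (convex_ball (0 : ℂ) ρ).isPreconnected

theorem monomialCoeffs_nonempty {κ : Type*} (c : κ → Fin n) {ρ : ℝ} (hρ : 0 < ρ) :
    (monomialCoeffs ρ c).Nonempty := by
  refine ⟨WithLp.toLp 2 fun _ => ((ρ / 2 : ℝ) : ℂ), fun k => ?_, fun i => ?_⟩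
  · simp only [Complex.norm_real, Real.norm_of_nonneg (half_pos hρ).le]
    exact half_lt_self hρ
  · simpa using hρ.ne'

end

section

variable {n : ℕ} {Y : Type*} [TopologicalSpace Y] [ChartedSpace (EuclideanSpace ℂ (Fin n)) Y]
  {ι : Type*}

/-! ### Deforming short arcs to monomial arcs -/

theorem Arc.ext {φ ψ : Arc n Y} (h : ∀ t, φ.toMap t = ψ.toMap t) : φ = ψ :=
  Subtype.ext (ContinuousMap.ext h)

/-- Holomorphic coordinate functions near the closed disk, with values in a polydisc of the chart,
define an arc. -/
theorem exists_arc_of_coord {e : OpenPartialHomeomorph Y (EuclideanSpace ℂ (Fin n))}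
    (he : e ∈ IsManifold.maximalAtlas 𝓘(ℂ, EuclideanSpace ℂ (Fin n)) ω Y) {ρ : ℝ}
    (hρ : polydisc n ρ ⊆ e.target) {x : ℂ → EuclideanSpace ℂ (Fin n)} {V : Set ℂ} (hV : IsOpen V)
    (hVb : Metric.closedBall (0 : ℂ) 1 ⊆ V) (hx : ∀ k, DifferentiableOn ℂ (fun t => x t k) V)
    (hxρ : ∀ t ∈ Metric.closedBall (0 : ℂ) 1, x t ∈ polydisc n ρ) :
    ∃ φ : Arc n Y, ∀ t : ClosedDisk, φ.toMap t = e.symm (x t) := by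
  have hxd : DifferentiableOn ℂ x V := differentiableOn_euclidean.2 hx
  refine ⟨Arc.ofMDifferentiableOn (fun t => e.symm (x t)) (V ∩ x ⁻¹' polydisc n ρ)
    (hxd.continuousOn.isOpen_inter_preimage hV (isOpen_polydisc ρ))
    (fun t ht => ⟨hVb ht, hxρ t ht⟩) ?_, fun t => rfl⟩
  exact (mdifferentiableOn_symm_of_mem_maximalAtlas he).comp
    (mdifferentiableOn_iff_differentiableOn.2 (hxd.mono Set.inter_subset_left))
    fun t ht => hρ ht.2

namespace IsSNCChart

variable {D : ι → Set Y} {p : Y} {e : OpenPartialHomeomorph Y (EuclideanSpace ℂ (Fin n))}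
  {c : {i : ι // p ∈ D i} → Fin n} {m : ι → ℕ}

/-- An arc whose coordinates are monomials with the prescribed exponents times units is a short arc
of type `m`, centered in the component of the stratum through `p`. -/
theorem mem_SA (h : IsSNCChart D p e c) (hm : m ≠ 0) (hp : p ∈ stratum D m) {ρ : ℝ}
    (hρ : polydisc n ρ ⊆ e.target) {φ : Arc n Y} {x : ℂ → EuclideanSpace ℂ (Fin n)}
    {v : Fin n → ℂ → ℂ} (hφ : ∀ t : ClosedDisk, φ.toMap t = e.symm (x t))
    (hx : ∀ t ∈ Metric.closedBall (0 : ℂ) 1, x t ∈ polydisc n ρ)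
    (hxv : ∀ t ∈ Metric.closedBall (0 : ℂ) 1, ∀ k, x t k = t ^ coordExponent c m k * v k t)
    (hv : ∀ k, AnalyticAt ℂ (v k) 0)
    (hv0 : ∀ i, ∀ t ∈ Metric.closedBall (0 : ℂ) 1, v (c i) t ≠ 0) :
    φ ∈ SA (n := n) D (connectedComponentIn (stratum D m) p) m := by
  have hφe : ∀ t : ClosedDisk, φ.toMap t ∈ e.source := fun t => by
    rw [hφ]
    exact e.map_target (hρ (hx t t.2))
  have hcoord : ∀ t : ClosedDisk, ∀ k, e (φ.toMap t) k = (t : ℂ) ^ coordExponent c m k * v k t :=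
    fun t k => by rw [hφ, e.right_inv (hρ (hx t t.2)), hxv t t.2]
  have hcen : φ.center ∈ e.source := hφe diskZero
  have hcenD : φ.center ∈ stratum D m := by
    rw [h.mem_stratum_iff hp hcen]
    intro k hk
    have h1 := hcoord diskZero k
    rw [show ((diskZero : ClosedDisk) : ℂ) = 0 from rfl, zero_pow hk, zero_mul] at h1
    exact h1
  have hshort : φ ∈ shortArcs (⋃ i, D i) := by
    refine Set.eq_singleton_iff_unique_mem.2 ⟨?_, fun t ht => ?_⟩
    · obtain ⟨i, hi⟩ := Function.ne_iff.1 hm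
      simp only [stratum, Set.mem_iInter] at hcenD
      exact Set.mem_iUnion.2 ⟨i, hcenD i (Nat.pos_of_ne_zero hi)⟩
    · obtain ⟨i, hi⟩ := Set.mem_iUnion.1 ht
      have hpi := h.center_mem_of_mem (hφe t) hi
      have h1 := (h.mem_iff (hφe t) hpi).1 hi
      rw [hcoord, mul_eq_zero] at h1
      exact Subtype.ext (eq_zero_of_pow_eq_zero (h1.resolve_right (hv0 _ t t.2)))
  have hρ0 : p ∈ e.source ∧ e p ∈ polydisc n ρ := by
    refine ⟨h.mem_source, ?_⟩
    rw [h.apply_center]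
    intro k
    have := hx 0 (by simp) k
    simpa using (norm_nonneg _).trans_lt this
  refine ⟨hshort, ?_, fun i => ?_⟩
  · refine h.mem_connectedComponentIn hp hρ hρ0.1 hρ0.2 hp hcen ?_ hcenD
    rw [show φ.center = e.symm (x 0) from hφ diskZero, e.right_inv (hρ (hx 0 (by simp)))]
    exact hx 0 (by simp)
  · by_cases hi : p ∈ D i
    · rw [intersectionNumber_eq h.mem_maximalAtlas (h.hyperplane ⟨i, hi⟩) hshort hcen,
        ← h.coordExponent_apply (m := m) ⟨i, hi⟩, ← analyticOrderAt_pow_mul (hv (c ⟨i, hi⟩))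
          (hv0 ⟨i, hi⟩ 0 (by simp))]
      apply analyticOrderAt_congr
      filter_upwards [Metric.closedBall_mem_nhds (0 : ℂ) one_pos] with t ht
      rw [φ.extension_eq ⟨t, ht⟩]
      exact hcoord ⟨t, ht⟩ _
    · have hmi : m i = 0 := by
        by_contra hmi
        simp only [stratum, Set.mem_iInter] at hp
        exact hi (hp i (Nat.pos_of_ne_zero hmi))
      rw [intersectionNumber_eq_zero hshort fun h' => hi (h.center_mem_of_mem hcen h'), hmi]
      simp

end IsSNCChart

theorem ofReal_mul_mem_closedBall (r : Set.Ioc (0 : ℝ) 1) {t : ℂ}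
    (ht : t ∈ Metric.closedBall (0 : ℂ) 1) : (r : ℝ) * t ∈ Metric.closedBall (0 : ℂ) 1 := by
  rw [mem_closedBall_zero_iff] at ht ⊢
  rw [norm_mul, Complex.norm_real, Real.norm_of_nonneg r.2.1.le]
  exact mul_le_one₀ r.2.2 (norm_nonneg _) ht

/-- Rescaling the disk by `r ∈ (0, 1]` gives a continuous family of arcs. -/
theorem exists_scale (φ : Arc n Y) : ∃ h : Set.Ioc (0 : ℝ) 1 → Arc n Y, Continuous h ∧
    ∀ r, ∀ t : ClosedDisk, (h r).toMap t = φ.extension (r * t) := by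
  obtain ⟨U, hU, hUb, hd, -⟩ := φ.extension_spec
  have hcont : ∀ r : Set.Ioc (0 : ℝ) 1, Continuous fun t : ℂ => (r : ℝ) * t := fun r => by fun_prop
  refine ⟨fun r => Arc.ofMDifferentiableOn (fun t => φ.extension ((r : ℝ) * t))
    ((fun t : ℂ => (r : ℝ) * t) ⁻¹' U) (hU.preimage (hcont r))
    (fun t ht => hUb (ofReal_mul_mem_closedBall r ht)) ?_,
    Arc.continuous_of_uncurry ?_, fun r t => rfl⟩
  · refine hd.comp (mdifferentiableOn_iff_differentiableOn.2 ?_) fun t ht => ht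
    exact (differentiable_id.const_mul _).differentiableOn
  · exact hd.continuousOn.comp_continuous
      (f := fun x : Set.Ioc (0 : ℝ) 1 × ClosedDisk => ((x.1 : ℝ) : ℂ) * (x.2 : ℂ)) (by fun_prop)
      fun x => hUb (ofReal_mul_mem_closedBall x.1 x.2.2)

/-- Rescaling the disk changes neither the center nor the orders of the coordinates there. -/
theorem scale_mem_SA {D : ι → Set Y} {W : Set Y} {m : ι → ℕ} {φ ψ : Arc n Y} {p : Y}
    {e : OpenPartialHomeomorph Y (EuclideanSpace ℂ (Fin n))} {c : {i : ι // p ∈ D i} → Fin n}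
    (h : IsSNCChart D p e c) (hφ : φ ∈ SA (n := n) D W m) (hφe : φ.center ∈ e.source)
    (r : Set.Ioc (0 : ℝ) 1) (hψ : ∀ t : ClosedDisk, ψ.toMap t = φ.extension (r * t)) :
    ψ ∈ SA (n := n) D W m := by
  have hr : ((r : ℝ) : ℂ) ≠ 0 := by exact_mod_cast r.2.1.ne'
  have hcen : ψ.center = φ.center := by
    have h1 := hψ diskZero
    rw [show ((diskZero : ClosedDisk) : ℂ) = 0 from rfl, mul_zero] at h1
    exact h1.trans (φ.extension_eq diskZero)
  have hshort : ψ ∈ shortArcs (⋃ i, D i) := by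
    refine Set.eq_singleton_iff_unique_mem.2 ⟨?_, fun t ht => ?_⟩
    · change ψ.center ∈ ⋃ i, D i
      rw [hcen]
      exact shortArcs_center_mem hφ.1
    · rw [Set.mem_preimage, hψ, φ.extension_eq ⟨_, ofReal_mul_mem_closedBall r t.2⟩] at ht
      have h1 : (r : ℝ) * (t : ℂ) = 0 := congrArg Subtype.val (shortArcs_eq_diskZero hφ.1 ht)
      exact Subtype.ext ((mul_eq_zero.1 h1).resolve_left hr)
  refine ⟨hshort, hcen ▸ hφ.2.1, fun i => ?_⟩
  rw [← hφ.2.2 i]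
  by_cases hi : p ∈ D i
  · rw [intersectionNumber_eq h.mem_maximalAtlas (h.hyperplane ⟨i, hi⟩) hshort (hcen ▸ hφe),
      intersectionNumber_eq h.mem_maximalAtlas (h.hyperplane ⟨i, hi⟩) hφ.1 hφe]
    have hd : deriv (fun t : ℂ => ((r : ℝ) : ℂ) * t) 0 ≠ 0 := by simpa using hr
    have h1 := analyticOrderAt_comp_of_deriv_ne_zero
      (f := fun t => e (φ.extension t) (c ⟨i, hi⟩)) (g := fun t : ℂ => ((r : ℝ) : ℂ) * t)
      (analyticAt_const.mul analyticAt_id) hd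
    simp only [mul_zero] at h1
    rw [← h1]
    apply analyticOrderAt_congr
    filter_upwards [Metric.closedBall_mem_nhds (0 : ℂ) one_pos] with t ht
    rw [ψ.extension_eq ⟨t, ht⟩, hψ]
    rfl
  · rw [intersectionNumber_eq_zero hshort fun h' => hi (h.center_mem_of_mem (hcen ▸ hφe) h'),
      intersectionNumber_eq_zero hφ.1 fun h' => hi (h.center_mem_of_mem hφe h')]

theorem connectedComponentIn_eq_of_continuous {S X : Type*} [TopologicalSpace S]
    [PreconnectedSpace S] [TopologicalSpace X] {A : Set X} {h : S → X} (hc : Continuous h)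
    (hA : ∀ s, h s ∈ A) (a b : S) : connectedComponentIn A (h a) = connectedComponentIn A (h b) :=
  connectedComponentIn_eq ((isPreconnected_range hc).subset_connectedComponentIn
    (Set.mem_range_self a) (Set.range_subset_iff.2 hA) (Set.mem_range_self b))

namespace IsSNCChart

variable {D : ι → Set Y} {p : Y} {e : OpenPartialHomeomorph Y (EuclideanSpace ℂ (Fin n))}
  {c : {i : ι // p ∈ D i} → Fin n} {m : ι → ℕ}

/-- The monomial arcs of a chart form a continuous family in one `SA`. -/
theorem exists_monomialArc (h : IsSNCChart D p e c) (hm : m ≠ 0) (hp : p ∈ stratum D m) {ρ : ℝ}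
    (hρ : polydisc n ρ ⊆ e.target) : ∃ M : monomialCoeffs (n := n) ρ c → Arc n Y, Continuous M ∧
      (∀ b, M b ∈ SA (n := n) D (connectedComponentIn (stratum D m) p) m) ∧
      ∀ b, ∀ t : ClosedDisk, (M b).toMap t = e.symm (monomialPoint (coordExponent c m) b t) := by
  have hex : ∀ b : monomialCoeffs (n := n) ρ c, ∃ φ : Arc n Y,
      ∀ t : ClosedDisk, φ.toMap t = e.symm (monomialPoint (coordExponent c m) b t) := fun b =>
    exists_arc_of_coord h.mem_maximalAtlas hρ isOpen_univ (Set.subset_univ _)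
      (fun k => ((differentiable_id.pow _).mul_const _).differentiableOn)
      fun t ht => monomialPoint_mem_polydisc _ b.2.1 ht
  choose M hM using hex
  refine ⟨M, Arc.continuous_of_uncurry ?_, fun b => ?_, hM⟩
  · simp only [hM]
    refine e.continuousOn_symm.comp_continuous
      ((continuous_monomialPoint _).comp (by fun_prop :
        Continuous fun x : monomialCoeffs (n := n) ρ c × ClosedDisk =>
          ((x.1 : EuclideanSpace ℂ (Fin n)), (x.2 : ℂ)))) fun x => ?_
    exact hρ (monomialPoint_mem_polydisc _ x.1.2.1 x.2.2)
  · exact h.mem_SA hm hp hρ (v := fun k _ => (b : EuclideanSpace ℂ (Fin n)) k) (hM b)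
      (fun t ht => monomialPoint_mem_polydisc _ b.2.1 ht) (fun t _ k => rfl)
      (fun k => analyticAt_const) fun i t _ => b.2.2 i

/-- The coordinates of a short arc near the origin: monomials times units. -/
theorem exists_coord_eq_pow_mul (h : IsSNCChart D p e c) {W : Set Y} {φ : Arc n Y}
    (hφ : φ ∈ SA (n := n) D W m) (hφe : φ.center ∈ e.source) :
    ∃ (V : Set ℂ) (u : Fin n → ℂ → ℂ), IsOpen V ∧ (0 : ℂ) ∈ V ∧
      (∀ t ∈ V, φ.extension t ∈ e.source) ∧ (∀ k, DifferentiableOn ℂ (u k) V) ∧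
      (∀ k, ∀ t ∈ V, e (φ.extension t) k = t ^ coordExponent c m k * u k t) ∧
      ∀ i, ∀ t ∈ V ∩ Metric.closedBall 0 1, u (c i) t ≠ 0 := by
  obtain ⟨V, hV, hφV, hVe, -, hVd⟩ := φ.exists_isOpen_differentiableOn_coord h.mem_maximalAtlas
  have h0V : (0 : ℂ) ∈ V := hφV diskZero hφe
  have hex : ∀ k, ∃ u : ℂ → ℂ, DifferentiableOn ℂ u V ∧
      (∀ t ∈ V, e (φ.extension t) k = t ^ coordExponent c m k * u t) ∧
      (k ∈ Set.range c → u 0 ≠ 0) := by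
    intro k
    by_cases hk : k ∈ Set.range c
    · obtain ⟨i, rfl⟩ := hk
      have hord := hφ.2.2 i
      rw [intersectionNumber_eq h.mem_maximalAtlas (h.hyperplane i) hφ.1 hφe,
        ← h.coordExponent_apply (m := m) i] at hord
      obtain ⟨u, hu, hu0, hfu⟩ := (hVd (c i)).exists_eq_pow_mul hV h0V hord
      exact ⟨u, hu, hfu, fun _ => hu0⟩
    · refine ⟨_, hVd k, fun t _ => ?_, fun hk' => absurd hk' hk⟩
      have h0 : coordExponent c m k = 0 := Function.extend_apply' _ _ _ hk
      rw [h0, pow_zero, one_mul]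
  choose u hu hfu hu0 using hex
  refine ⟨V, u, hV, h0V, hVe, hu, hfu, fun i t ht ht0 => ?_⟩
  by_cases h0 : t = 0
  · exact hu0 (c i) (Set.mem_range_self i) (h0 ▸ ht0)
  · refine coord_ne_zero (h.hyperplane i) hφ.1 ht.2 (hVe t ht.1) h0 ?_
    rw [hfu _ t ht.1, ht0, mul_zero]

end IsSNCChart

/-- A short arc centered in the polydisc is deformed to a monomial arc in two steps: shrink the
disk to `φ (r t)` for a small `r`, so that the whole arc lies in the polydisc, with coordinates
`(r t) ^ μ k * u k (r t)`; then replace `u k (r t)` by `u k (s r t)` and let `s` go from `1` to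
`0`. -/
theorem IsSNCChart.exists_connectedComponentIn_eq {D : ι → Set Y} {p : Y}
    {e : OpenPartialHomeomorph Y (EuclideanSpace ℂ (Fin n))}
    {c : {i : ι // p ∈ D i} → Fin n} {m : ι → ℕ} (h : IsSNCChart D p e c) (hm : m ≠ 0)
    (hp : p ∈ stratum D m) {ρ : ℝ} (hρ : polydisc n ρ ⊆ e.target) {A : Set (Arc n Y)}
    (hA : A = SA (n := n) D (connectedComponentIn (stratum D m) p) m)
    {M : monomialCoeffs (n := n) ρ c → Arc n Y}
    (hM : ∀ b, ∀ t : ClosedDisk, (M b).toMap t = e.symm (monomialPoint (coordExponent c m) b t))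
    {φ : Arc n Y} (hφ : φ ∈ A) (hφe : φ.center ∈ e.source) (hφρ : e φ.center ∈ polydisc n ρ) :
    ∃ b, connectedComponentIn A φ = connectedComponentIn A (M b) := by
  subst hA
  -- The radius `r` is chosen so that all coordinates `w ^ μ k * u k z` with `‖w‖, ‖z‖ ≤ r` stay in
  -- the polydisc.
  obtain ⟨V, u, hV, h0V, hVe, hu, hfu, hu0⟩ := h.exists_coord_eq_pow_mul hφ hφe
  have hucont : ∀ k, ContinuousAt (u k) 0 := fun k =>
    (hu k).continuousOn.continuousAt (hV.mem_nhds h0V)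
  have hnear : ∀ᶠ x : ℂ × ℂ in 𝓝 (0, 0),
      x.2 ∈ V ∧ ∀ k, ‖x.1 ^ coordExponent c m k * u k x.2‖ < ρ := by
    refine (continuousAt_snd.eventually (hV.eventually_mem h0V)).and
      (Filter.eventually_all.2 fun k => ?_)
    have hc : ContinuousAt (fun x : ℂ × ℂ => ‖x.1 ^ coordExponent c m k * u k x.2‖) (0, 0) :=
      ((continuousAt_fst.pow _).mul
        (ContinuousAt.comp (f := Prod.snd) (x := ((0 : ℂ), (0 : ℂ))) (hucont k)
          continuousAt_snd)).norm
    refine hc.eventually (gt_mem_nhds ?_)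
    have h1 := hfu k 0 h0V
    rw [show φ.extension 0 = φ.center from φ.extension_eq diskZero] at h1
    change ‖(0 : ℂ) ^ coordExponent c m k * u k 0‖ < ρ
    rw [← h1]
    exact hφρ k
  obtain ⟨δ, hδ, hball⟩ := Metric.eventually_nhds_iff.1 hnear
  have hsmall : ∀ w z : ℂ, ‖w‖ < δ → ‖z‖ < δ →
      z ∈ V ∧ ∀ k, ‖w ^ coordExponent c m k * u k z‖ < ρ := fun w z hw hz =>
    hball (y := (w, z)) (by simp [Prod.dist_eq, hw, hz])
  obtain ⟨r, hr0, hr1, hrδ⟩ : ∃ r : ℝ, 0 < r ∧ r ≤ 1 ∧ r < δ :=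
    ⟨min (δ / 2) 1, lt_min (half_pos hδ) one_pos, min_le_right _ _,
      (min_le_left _ _).trans_lt (half_lt_self hδ)⟩
  have hrC : (r : ℂ) ≠ 0 := by exact_mod_cast hr0.ne'
  have hrt : ∀ t ∈ Metric.closedBall (0 : ℂ) 1, ‖(r : ℂ) * t‖ ≤ r := fun t ht => by
    rw [mem_closedBall_zero_iff] at ht
    rw [norm_mul, Complex.norm_real, Real.norm_of_nonneg hr0.le]
    exact mul_le_of_le_one_right hr0.le ht
  have hsrt : ∀ s : Set.Icc (0 : ℝ) 1, ∀ t ∈ Metric.closedBall (0 : ℂ) 1,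
      ‖((s : ℝ) : ℂ) * (r * t)‖ ≤ r := fun s t ht => by
    rw [norm_mul, Complex.norm_real, Real.norm_of_nonneg s.2.1]
    exact (mul_le_of_le_one_left (norm_nonneg _) s.2.2).trans (hrt t ht)
  have hsV : ∀ s : Set.Icc (0 : ℝ) 1, ∀ t ∈ Metric.closedBall (0 : ℂ) 1,
      ((s : ℝ) : ℂ) * (r * t) ∈ V := fun s t ht =>
    (hsmall 0 _ (by simpa using hδ) ((hsrt s t ht).trans_lt hrδ)).1
  let x : Set.Icc (0 : ℝ) 1 → ℂ → EuclideanSpace ℂ (Fin n) := fun s t =>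
    WithLp.toLp 2 fun k => (r * t) ^ coordExponent c m k * u k ((s : ℝ) * (r * t))
  have hxρ : ∀ s, ∀ t ∈ Metric.closedBall (0 : ℂ) 1, x s t ∈ polydisc n ρ := fun s t ht k =>
    (hsmall _ _ ((hrt t ht).trans_lt hrδ) ((hsrt s t ht).trans_lt hrδ)).2 k
  have hlin : ∀ s : Set.Icc (0 : ℝ) 1,
      Differentiable ℂ fun t : ℂ => ((s : ℝ) : ℂ) * (r * t) := fun s => by fun_prop
  have hudiff : ∀ s : Set.Icc (0 : ℝ) 1, ∀ k, DifferentiableOn ℂ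
      (fun t : ℂ => u k ((s : ℝ) * (r * t))) ((fun t : ℂ => ((s : ℝ) : ℂ) * (r * t)) ⁻¹' V) :=
    fun s k => (hu k).comp (hlin s).differentiableOn fun t ht => ht
  have hopen : ∀ s : Set.Icc (0 : ℝ) 1, IsOpen ((fun t : ℂ => ((s : ℝ) : ℂ) * (r * t)) ⁻¹' V) :=
    fun s => hV.preimage (hlin s).continuous
  have hex : ∀ s, ∃ ψ : Arc n Y, ∀ t : ClosedDisk, ψ.toMap t = e.symm (x s t) := fun s =>
    exists_arc_of_coord h.mem_maximalAtlas hρ (hopen s) (hsV s)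
      (fun k => DifferentiableOn.mul
        (by fun_prop : Differentiable ℂ fun t : ℂ => (r * t) ^ coordExponent c m k).differentiableOn
        (hudiff s k))
      (hxρ s)
  choose H hH using hex
  have hHA : ∀ s, H s ∈ SA (n := n) D (connectedComponentIn (stratum D m) p) m := fun s => by
    refine h.mem_SA hm hp hρ (hH s) (hxρ s)
      (v := fun k t => (r : ℂ) ^ coordExponent c m k * u k ((s : ℝ) * (r * t)))
      (fun t _ k => ?_) (fun k => ?_) fun i t ht => ?_
    · simp only [x]
      ring
    · exact analyticAt_const.mul
        ((hudiff s k).analyticAt ((hopen s).mem_nhds (hsV s 0 (by simp))))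
    · refine mul_ne_zero (pow_ne_zero _ hrC) (hu0 i _ ⟨hsV s t ht, ?_⟩)
      rw [mem_closedBall_zero_iff]
      exact (hsrt s t ht).trans hr1
  have hHc : Continuous H := by
    refine Arc.continuous_of_uncurry ?_
    simp only [hH]
    refine e.continuousOn_symm.comp_continuous (f := fun y : Set.Icc (0 : ℝ) 1 × ClosedDisk =>
      x y.1 y.2) ?_ fun y => hρ (hxρ y.1 y.2 y.2.2)
    refine (PiLp.continuous_toLp 2 _).comp (continuous_pi fun k => ?_)
    refine Continuous.mul (by fun_prop) ?_
    exact (hu k).continuousOn.comp_continuous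
      (f := fun y : Set.Icc (0 : ℝ) 1 × ClosedDisk => ((y.1 : ℝ) : ℂ) * (r * (y.2 : ℂ)))
      (by fun_prop) fun y => hsV y.1 y.2 y.2.2
  -- The chain of deformations is `φ = S 1`, `S r = H 1`, `H 0 = M b`.
  obtain ⟨S, hSc, hS⟩ := exists_scale φ
  have hSA : ∀ q, S q ∈ SA (n := n) D (connectedComponentIn (stratum D m) p) m := fun q =>
    scale_mem_SA h hφ hφe q (hS q)
  have hS1 : S ⟨1, one_pos, le_rfl⟩ = φ := Arc.ext fun t => by
    rw [hS, ← φ.extension_eq]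
    simp
  have hSH : S ⟨r, hr0, hr1⟩ = H ⟨1, zero_le_one, le_rfl⟩ := Arc.ext fun t => by
    have htV := hsV ⟨1, zero_le_one, le_rfl⟩ t t.2
    simp only [Complex.ofReal_one, one_mul] at htV
    rw [hS, hH, ← e.left_inv (hVe _ htV)]
    congr 1
    ext k
    simp only [x, hfu k _ htV, Complex.ofReal_one, one_mul]
  have h0 : ((⟨0, le_rfl, zero_le_one⟩ : Set.Icc (0 : ℝ) 1) : ℝ) = 0 := rfl
  have hb : WithLp.toLp 2 (fun k => (r : ℂ) ^ coordExponent c m k * u k 0) ∈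
      monomialCoeffs (n := n) ρ c := by
    refine ⟨fun k => ?_, fun i => mul_ne_zero (pow_ne_zero _ hrC)
      (hu0 i 0 ⟨h0V, by simp⟩)⟩
    have := hxρ ⟨0, le_rfl, zero_le_one⟩ 1 (by simp) k
    simpa only [x, mul_one, Complex.ofReal_zero, zero_mul] using this
  have hHM : H ⟨0, le_rfl, zero_le_one⟩ = M ⟨_, hb⟩ := Arc.ext fun t => by
    rw [hH, hM]
    congr 1
    ext k
    simp only [x, monomialPoint, Complex.ofReal_zero, zero_mul]
    ring
  have : PreconnectedSpace (Set.Ioc (0 : ℝ) 1) := Subtype.preconnectedSpace isPreconnected_Ioc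
  have : PreconnectedSpace (Set.Icc (0 : ℝ) 1) := Subtype.preconnectedSpace isPreconnected_Icc
  refine ⟨⟨_, hb⟩, ?_⟩
  rw [← hS1, connectedComponentIn_eq_of_continuous hSc hSA _ ⟨r, hr0, hr1⟩, hSH,
    connectedComponentIn_eq_of_continuous hHc hHA _ ⟨0, le_rfl, zero_le_one⟩, hHM]

/-! ### Connectedness of the sets of short arcs with fixed intersection numbers -/

variable [IsManifold 𝓘(ℂ, EuclideanSpace ℂ (Fin n)) ω Y] {D : ι → Set Y} {m : ι → ℕ}

/-- The arcs of `SA` whose center is near a given point lie in one component of `SA`. -/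
theorem IsSNCDivisor.exists_eventually_connectedComponentIn_eq (hD : IsSNCDivisor (n := n) D)
    (hm : m ≠ 0) {p : Y} (hp : p ∈ stratum D m) {A : Set (Arc n Y)}
    (hA : A = SA (n := n) D (connectedComponentIn (stratum D m) p) m) :
    ∃ C, ∀ᶠ y in 𝓝 p, ∀ φ ∈ A, φ.center = y → connectedComponentIn A φ = C := by
  obtain ⟨e, c, h⟩ := hD.exists_isSNCChart p
  obtain ⟨ρ, hρ, hρt, -⟩ := h.exists_polydisc_subset_target Filter.univ_mem
  obtain ⟨M, hMc, hMA, hM⟩ := h.exists_monomialArc hm hp hρt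
  obtain ⟨b₀, hb₀⟩ := monomialCoeffs_nonempty c hρ
  have : PreconnectedSpace (monomialCoeffs (n := n) ρ c) :=
    Subtype.preconnectedSpace (isPreconnected_monomialCoeffs c ρ)
  refine ⟨connectedComponentIn A (M ⟨b₀, hb₀⟩), ?_⟩
  filter_upwards [h.preimage_polydisc_mem_nhds hρ] with y hy φ hφ hφy
  subst hφy
  obtain ⟨b, hb⟩ := h.exists_connectedComponentIn_eq hm hp hρt hA hM hφ hy.1 hy.2
  rw [hb]
  exact connectedComponentIn_eq_of_continuous hMc (fun b => hA ▸ hMA b) _ _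

/-- The centers of the arcs of `SA` are dense in `W`, although they avoid the components of the
divisor that do not contain `W`. -/
theorem IsSNCDivisor.frequently_center (hD : IsSNCDivisor (n := n) D)
    (hm : m ≠ 0) {p : Y} (hp : p ∈ stratum D m) :
    ∃ᶠ y in 𝓝 p, ∃ φ ∈ SA (n := n) D (connectedComponentIn (stratum D m) p) m, φ.center = y := by
  rw [Filter.frequently_iff]
  intro U hU
  obtain ⟨e, c, h⟩ := hD.exists_isSNCChart p
  obtain ⟨ρ, hρ, hρt, hρU⟩ := h.exists_polydisc_subset_target hU
  obtain ⟨M, hMc, hMA, hM⟩ := h.exists_monomialArc hm hp hρt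
  obtain ⟨b, hb⟩ := monomialCoeffs_nonempty c hρ
  refine ⟨_, ?_, M ⟨b, hb⟩, hMA _, rfl⟩
  rw [show (M ⟨b, hb⟩).center = e.symm _ from hM ⟨b, hb⟩ diskZero]
  exact hρU _ (monomialPoint_mem_polydisc _ hb.1 diskZero.2)

/-- The component of `SA` that contains the arcs centered near `p` is a locally constant function
of `p ∈ W`, hence constant. -/
theorem IsSNCDivisor.isConnected_SA (hD : IsSNCDivisor (n := n) D) (hm : m ≠ 0) {W : Set Y}
    (hW : W ∈ componentsOf (stratum D m)) : IsConnected (SA (n := n) D W m) := by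
  obtain ⟨x, hx, rfl⟩ := hW
  set W := connectedComponentIn (stratum D m) x with hWdef
  have hWp : ∀ p ∈ W, p ∈ stratum D m ∧ W = connectedComponentIn (stratum D m) p := fun p hp =>
    ⟨connectedComponentIn_subset _ _ hp, connectedComponentIn_eq hp⟩
  have hfreq : ∀ p ∈ W, ∃ᶠ y in 𝓝 p, ∃ φ ∈ SA (n := n) D W m, φ.center = y := fun p hp => by
    have := hD.frequently_center hm (hWp p hp).1
    rwa [← (hWp p hp).2] at this
  refine ⟨?_, isPreconnected_of_forall_pair fun φ hφ ψ hψ => ?_⟩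
  · obtain ⟨y, φ, hφ, -⟩ := (hfreq x (mem_connectedComponentIn hx)).exists
    exact ⟨φ, hφ⟩
  let A := SA (n := n) D W m
  let Q : Set (Arc n Y) → Y → Prop := fun C p =>
    ∀ᶠ y in 𝓝 p, ∀ φ ∈ A, φ.center = y → connectedComponentIn A φ = C
  have hQ : ∃ C, Q C φ.center ∧ Q C ψ.center := by
    -- Transitivity is where density of the centers enters: two neighbourhoods of the same point
    -- contain the center of a common arc.
    refine (isPreconnected_connectedComponentIn (x := x) (F := stratum D m)).induction₂
      (fun p q => ∃ C, Q C p ∧ Q C q) (fun p hp => ?_) ?_ ?_ hφ.2.1 hψ.2.1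
    · obtain ⟨C, hC⟩ := hD.exists_eventually_connectedComponentIn_eq hm (hWp p hp).1 (A := A)
        (by rw [← (hWp p hp).2])
      filter_upwards [nhdsWithin_le_nhds hC.eventually_nhds] with q hq
      exact ⟨C, hC, hq⟩
    · rintro p q r - hq - ⟨C, hCp, hCq⟩ ⟨C', hCq', hCr⟩
      obtain ⟨y, ⟨θ, hθ, hθy⟩, h1, h2⟩ := ((hfreq q hq).and_eventually (hCq.and hCq')).exists
      rw [← h1 θ hθ hθy, h2 θ hθ hθy] at hCp
      exact ⟨C', hCp, hCr⟩
    · rintro p q - - ⟨C, h1, h2⟩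
      exact ⟨C, h2, h1⟩
  obtain ⟨C, h1, h2⟩ := hQ
  have h3 := h1.self_of_nhds φ hφ rfl
  have h4 := h2.self_of_nhds ψ hψ rfl
  refine ⟨connectedComponentIn A φ, connectedComponentIn_subset _ _, mem_connectedComponentIn hφ,
    ?_, isPreconnected_connectedComponentIn⟩
  rw [h3, ← h4]
  exact mem_connectedComponentIn hψ

/-- Each `SA` is relatively open, and the short arcs outside it are covered by other sets `SA`;
so a preconnected set of short arcs that meets `SA` lies in it. -/
theorem IsSNCDivisor.connectedComponentIn_shortArcs_eq (hD : IsSNCDivisor (n := n) D) (hm : m ≠ 0)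
    {W : Set Y} (hW : W ∈ componentsOf (stratum D m)) {φ : Arc n Y}
    (hφ : φ ∈ SA (n := n) D W m) :
    connectedComponentIn (shortArcs (⋃ i, D i)) φ = SA (n := n) D W m := by
  apply Set.Subset.antisymm
  · intro ψ hψ
    refine (isPreconnected_connectedComponentIn (x := φ) (F := shortArcs (⋃ i, D i))).induction₂
      (fun α β => ∀ m : ι → ℕ, ∀ W ∈ componentsOf (stratum D m),
        (α ∈ SA (n := n) D W m ↔ β ∈ SA (n := n) D W m)) (fun α hα => ?_)
      (fun α β γ _ _ _ h1 h2 m W hW => (h1 m W hW).trans (h2 m W hW))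
      (fun α β _ _ h1 m W hW => (h1 m W hW).symm)
      (mem_connectedComponentIn hφ.1) hψ m W hW |>.1 hφ
    obtain ⟨m', -, W', hW', hα'⟩ := exists_mem_SA hD (connectedComponentIn_subset _ _ hα)
    filter_upwards [nhdsWithin_mono _ (connectedComponentIn_subset _ _)
      (eventually_mem_SA hD hW' hα')] with β hβ m W hW
    have key : ∀ {α β : Arc n Y}, α ∈ SA (n := n) D W' m' → β ∈ SA (n := n) D W' m' →
        α ∈ SA (n := n) D W m → β ∈ SA (n := n) D W m := by
      intro α β hα hβ h
      have hmm : m = m' := funext fun i => by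
        exact_mod_cast (h.2.2 i).symm.trans (hα.2.2 i)
      subst hmm
      obtain ⟨x, -, rfl⟩ := hW
      obtain ⟨x', -, rfl⟩ := hW'
      rw [connectedComponentIn_eq h.2.1, ← connectedComponentIn_eq hα.2.1]
      exact hβ
    exact ⟨key hα' hβ, key hβ hα'⟩
  · exact (hD.isConnected_SA hm hW).isPreconnected.subset_connectedComponentIn hφ fun ψ hψ => hψ.1

end

end

theorem mainTheorem11 {n : ℕ} {Y : Type*} [TopologicalSpace Y] [T2Space Y]
    [ChartedSpace (EuclideanSpace ℂ (Fin n)) Y]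
    [IsManifold 𝓘(ℂ, EuclideanSpace ℂ (Fin n)) ω Y]
    {ι : Type*} (D : ι → Set Y) (hD : IsSNCDivisor (n := n) D) :
    (∀ m : ι → ℕ, m ≠ 0 → ∀ W ∈ componentsOf (stratum D m),
      IsConnected (SA (n := n) D W m)) ∧
    componentsOf (shortArcs (n := n) (⋃ i, D i)) =
      {S | ∃ m : ι → ℕ, m ≠ 0 ∧ ∃ W ∈ componentsOf (stratum D m), S = SA (n := n) D W m} := by
  refine ⟨fun m hm W hW => hD.isConnected_SA hm hW, Set.ext fun S => ⟨?_, ?_⟩⟩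
  · rintro ⟨φ, hφ, rfl⟩
    obtain ⟨m, hm, W, hW, hφW⟩ := exists_mem_SA hD hφ
    exact ⟨m, hm, W, hW, hD.connectedComponentIn_shortArcs_eq hm hW hφW⟩
  · rintro ⟨m, hm, W, hW, rfl⟩
    obtain ⟨φ, hφ⟩ := (hD.isConnected_SA hm hW).nonempty
    exact ⟨φ, hφ.1, (hD.connectedComponentIn_shortArcs_eq hm hW hφ).symm⟩
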